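/- Consider a discrete memoryless state-dependent two-user interference channel with finite alphabets: i.i.d. (possibly correlated) state pairs $(S_{1},S_{2})\sim P_{S_1S_2}$ and transition law $P_{Y_1Y_2|S_1S_2X_1X_2}$. A length-$n$ code has encoders $x_k^n=f_k(w_k,s_1^n,s_2^n)$ (both state sequences are known noncausally at both transmitters) and decoders $\hat w_k=g_k(y_k^n)$, $k=1,2$. A pair of rates $R_1,R_2\ge 0$ is achievable if there is a sequence of such codes with $2^{nR_k}$ (rounded up to an integer) messages for user $k$ whose average probability of the event $(\hat w_1,\hat w_2)\neq(w_1,w_2)$, over uniformly distributed message pairs, tends to $0$ as $n\to\infty$; the capacity region is the closure of the set of achievable pairs. Mutual informations are in bits. Let $U_1,U_2,V$ be auxiliary random variables with finite alphabets and let $$P_{S_1S_2}\,P_{V|S_1}\,P_{X_2|VS_1}\,P_{U_1|S_1}\,P_{U_2|S_1U_1}\,P_{X_1|S_1U_1U_2}\,P_{Y_1Y_2|S_1S_2X_1X_2}$$ be the joint distribution. Then every rate pair $R_1,R_2\ge 0$ with $$R_1\le \min\{I(U_1;Y_1),I(U_1;Y_2)\}+\min\{I(U_2;VY_1|U_1),I(U_2;VY_2|U_1)\}-I(U_1U_2;S_1),$$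 $$R_2\le \min\{I(V;Y_1|U_1),I(V;Y_2|U_1)\}-I(V;S_1)$$ belongs to the capacity region, and it is itself achievable if both inequalities are strict. -/

import Mathlib

open Filter Topology

noncomputable section

/-! ### Information measures of finite random variables (logarithms to base 2) -/

open Classical in
/-- `P[X = x]` for a random variable `X` on a finite space with mass function `p`. -/
def probEq {Ω α : Type*} [Fintype Ω] (p : Ω → ℝ) (X : Ω → α) (x : α) : ℝ :=
  ∑ ω, if X ω = x then p ω else 0

/-- Mutual information `I(X;Y) = E[log (P(X,Y) / (P(X) P(Y)))]`, in bits. -/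
def mutualInfo {Ω α β : Type*} [Fintype Ω] (p : Ω → ℝ) (X : Ω → α) (Y : Ω → β) : ℝ :=
  ∑ ω, p ω * Real.logb 2
    (probEq p (fun ω' => (X ω', Y ω')) (X ω, Y ω) / (probEq p X (X ω) * probEq p Y (Y ω)))

/-- Conditional mutual information
`I(X;Y|Z) = E[log (P(X,Y,Z) P(Z) / (P(X,Z) P(Y,Z)))]`, in bits. -/
def condMutualInfo {Ω α β γ : Type*} [Fintype Ω] (p : Ω → ℝ)
    (X : Ω → α) (Y : Ω → β) (Z : Ω → γ) : ℝ :=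
  ∑ ω, p ω * Real.logb 2
    ((probEq p (fun ω' => (X ω', Y ω', Z ω')) (X ω, Y ω, Z ω) * probEq p Z (Z ω)) /
      (probEq p (fun ω' => (X ω', Z ω')) (X ω, Z ω) *
        probEq p (fun ω' => (Y ω', Z ω')) (Y ω, Z ω)))

/-! ### The state-dependent interference channel -/

/-- A memoryless state-dependent two-user interference channel: the law of the (possibly
correlated) state pair of one channel use, and the transition law
`P_{Y₁Y₂|S₁S₂X₁X₂}` of one channel use. -/
structure StateIC (S₁ S₂ X₁ X₂ Y₁ Y₂ : Type*) where
  stateLaw : PMF (S₁ × S₂)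
  trans : S₁ → S₂ → X₁ → X₂ → PMF (Y₁ × Y₂)

/-- A length-`n` code with message sets of sizes `M₁` and `M₂`. Each encoder sees its own message
and both whole state sequences (noncausally); decoder `k` sees only `y_k^n`. -/
structure ICCode (S₁ S₂ X₁ X₂ Y₁ Y₂ : Type*) (n M₁ M₂ : ℕ) where
  enc₁ : Fin M₁ → (Fin n → S₁) → (Fin n → S₂) → (Fin n → X₁)
  enc₂ : Fin M₂ → (Fin n → S₁) → (Fin n → S₂) → (Fin n → X₂)
  dec₁ : (Fin n → Y₁) → Fin M₁
  dec₂ : (Fin n → Y₂) → Fin M₂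

namespace StateIC

variable {S₁ S₂ X₁ X₂ Y₁ Y₂ : Type*}
  [Fintype S₁] [Fintype S₂] [Fintype Y₁] [Fintype Y₂]

/-- `Pr{(ŵ₁, ŵ₂) ≠ (w₁, w₂)}` when the messages `w₁`, `w₂` are sent; the states are i.i.d. and the
channel is memoryless. -/
def errorProb (ch : StateIC S₁ S₂ X₁ X₂ Y₁ Y₂) {n M₁ M₂ : ℕ}
    (c : ICCode S₁ S₂ X₁ X₂ Y₁ Y₂ n M₁ M₂) (w₁ : Fin M₁) (w₂ : Fin M₂) : ℝ :=
  ∑ s₁ : Fin n → S₁, ∑ s₂ : Fin n → S₂, ∑ y₁ : Fin n → Y₁, ∑ y₂ : Fin n → Y₂,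
    if (c.dec₁ y₁, c.dec₂ y₂) ≠ (w₁, w₂) then
      (∏ i, (ch.stateLaw (s₁ i, s₂ i)).toReal) *
        ∏ i, (ch.trans (s₁ i) (s₂ i) (c.enc₁ w₁ s₁ s₂ i) (c.enc₂ w₂ s₁ s₂ i)
          (y₁ i, y₂ i)).toReal
    else 0

/-- Average probability of error, over uniformly distributed message pairs. -/
def avgError (ch : StateIC S₁ S₂ X₁ X₂ Y₁ Y₂) {n M₁ M₂ : ℕ}
    (c : ICCode S₁ S₂ X₁ X₂ Y₁ Y₂ n M₁ M₂) : ℝ :=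
  (1 / ((M₁ : ℝ) * (M₂ : ℝ))) * ∑ w₁ : Fin M₁, ∑ w₂ : Fin M₂, ch.errorProb c w₁ w₂

/-- The number of messages at rate `R` and blocklength `n`: `2 ^ (n R)`, rounded up. -/
def numMessages (R : ℝ) (n : ℕ) : ℕ := ⌈(2 : ℝ) ^ ((n : ℝ) * R)⌉₊

/-- The pair `(R₁, R₂)` of nonnegative rates is achievable: some sequence of codes with
`2 ^ (n R₁)` and `2 ^ (n R₂)` messages has average error probability tending to `0`. -/
def Achievable (ch : StateIC S₁ S₂ X₁ X₂ Y₁ Y₂) (R₁ R₂ : ℝ) : Prop :=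
  0 ≤ R₁ ∧ 0 ≤ R₂ ∧
    ∃ c : ∀ n : ℕ, ICCode S₁ S₂ X₁ X₂ Y₁ Y₂ n (numMessages R₁ n) (numMessages R₂ n),
      Tendsto (fun n => ch.avgError (c n)) atTop (𝓝 0)

/-- The capacity region: the closure of the set of achievable rate pairs. -/
def capacityRegion (ch : StateIC S₁ S₂ X₁ X₂ Y₁ Y₂) : Set (ℝ × ℝ) :=
  closure {R | ch.Achievable R.1 R.2}

end StateIC

/-! ### Auxiliary random variables -/

/-- A choice of the conditional laws
`P_{V|S₁} P_{X₂|VS₁} P_{U₁|S₁} P_{U₂|S₁U₁} P_{X₁|S₁U₁U₂}`. -/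
structure AuxLaw (S₁ X₁ X₂ U₁ U₂ V : Type*) where
  lawV : S₁ → PMF V
  lawX₂ : V → S₁ → PMF X₂
  lawU₁ : S₁ → PMF U₁
  lawU₂ : S₁ → U₁ → PMF U₂
  lawX₁ : S₁ → U₁ → U₂ → PMF X₁

/-- The values of `(S₁, S₂, V, X₂, U₁, U₂, X₁, Y₁, Y₂)`. -/
abbrev JointSpace (S₁ S₂ X₁ X₂ Y₁ Y₂ U₁ U₂ V : Type*) :=
  S₁ × S₂ × V × X₂ × U₁ × U₂ × X₁ × Y₁ × Y₂

namespace JointSpace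

variable {S₁ S₂ X₁ X₂ Y₁ Y₂ U₁ U₂ V : Type*}

/-- The state at receiver 1, as a random variable. -/
def rvS₁ (ω : JointSpace S₁ S₂ X₁ X₂ Y₁ Y₂ U₁ U₂ V) : S₁ := ω.1

/-- The auxiliary random variable `V`. -/
def rvV (ω : JointSpace S₁ S₂ X₁ X₂ Y₁ Y₂ U₁ U₂ V) : V := ω.2.2.1

/-- The auxiliary random variable `U₁`. -/
def rvU₁ (ω : JointSpace S₁ S₂ X₁ X₂ Y₁ Y₂ U₁ U₂ V) : U₁ := ω.2.2.2.2.1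

/-- The auxiliary random variable `U₂`. -/
def rvU₂ (ω : JointSpace S₁ S₂ X₁ X₂ Y₁ Y₂ U₁ U₂ V) : U₂ := ω.2.2.2.2.2.1

/-- The output at receiver 1. -/
def rvY₁ (ω : JointSpace S₁ S₂ X₁ X₂ Y₁ Y₂ U₁ U₂ V) : Y₁ := ω.2.2.2.2.2.2.2.1

/-- The output at receiver 2. -/
def rvY₂ (ω : JointSpace S₁ S₂ X₁ X₂ Y₁ Y₂ U₁ U₂ V) : Y₂ := ω.2.2.2.2.2.2.2.2

end JointSpace

/-- The joint law `P_{S₁S₂} P_{V|S₁} P_{X₂|VS₁} P_{U₁|S₁} P_{U₂|S₁U₁} P_{X₁|S₁U₁U₂}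
P_{Y₁Y₂|S₁S₂X₁X₂}`. -/
def StateIC.jointLaw {S₁ S₂ X₁ X₂ Y₁ Y₂ U₁ U₂ V : Type*}
    (ch : StateIC S₁ S₂ X₁ X₂ Y₁ Y₂) (q : AuxLaw S₁ X₁ X₂ U₁ U₂ V) :
    JointSpace S₁ S₂ X₁ X₂ Y₁ Y₂ U₁ U₂ V → ℝ :=
  fun (s₁, s₂, v, x₂, u₁, u₂, x₁, y₁, y₂) =>
    (ch.stateLaw (s₁, s₂)).toReal * (q.lawV s₁ v).toReal * (q.lawX₂ v s₁ x₂).toReal *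
      (q.lawU₁ s₁ u₁).toReal * (q.lawU₂ s₁ u₁ u₂).toReal * (q.lawX₁ s₁ u₁ u₂ x₁).toReal *
      (ch.trans s₁ s₂ x₁ x₂ (y₁, y₂)).toReal

end

/-! The proof is random coding with likelihood encoders and joint threshold decoding. Write U =
(U₁,U₂); no superposition structure is needed, since U serves as a single letter. User 1 has an
i.i.d. codebook drawn from the marginal of U, user 2 one drawn from the marginal of V, with about
2^(n r₁) and 2^(n r₂) codewords for each message. Given the state sequence, an encoder picks one of
the codewords of its message with probability proportional to the density of that codeword given the
state.

Soft covering (`soft_covering`) shows that for r₁ > I(U;S₁) and r₂ > I(V;S₁) these encoders may be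
replaced, at vanishing cost, by an ideal weighting (`likelihood_pair_le`,
`codeMean_randomError_le`). Under that weighting the chosen codewords, the state and the outputs
follow the single-letter joint law, while every other codeword remains independent of them. This
avoids the dependence of the chosen index on the rest of the codebook.

Receiver 1 looks for a message with a codeword that passes a test together with some codeword of
user 2, which need not be right; receiver 2 does the same with the roles exchanged. A change of
measure (`wmean_iid_test_le`) bounds the probability of a false pass, and Chebyshev's inequality for
log densities shows that the true pair passes. Receiver 1 succeeds if R₁ + r₁ < I(U;VY₁) and R₁ + r₁
+ R₂ + r₂ is below the total correlation of U, V, Y₁; receiver 2 if R₂ + r₂ < I(V;UY₂) and the same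
sum is below the total correlation of U, V, Y₂. Chain rules and nonnegativity of information derive
all four from the stated bounds. For instance, each total correlation is I(U₁;Y) + I(U₂;VY|U₁) +
I(V;Y|U₁) + I(V;U₁), and its last term can be dropped.

A user of rate zero has exactly one message, so the conditions of its receiver fall away. This is
what makes the boundary work: a pair with non-strict inequalities is a limit of pairs in which each
rate is either zero or strictly below its bound, and `StateIC.achievable_of_le` covers those. -/

/-! ### Weighted means over finite types -/

/-- The weighted sum `∑ p a * f a`; the expectation of `f` when `p` is a mass function. -/
noncomputable def wmean {α : Type*} [Fintype α] (p : α → ℝ) (f : α → ℝ) : ℝ := ∑ a, p a * f a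

/-- `p` is a probability mass function with real values. -/
def IsMass {α : Type*} [Fintype α] (p : α → ℝ) : Prop := (∀ a, 0 ≤ p a) ∧ ∑ a, p a = 1

/-- The mass function of an i.i.d. family. -/
noncomputable def iidMass {ι α : Type*} [Fintype ι] (p : α → ℝ) (C : ι → α) : ℝ := ∏ i, p (C i)

open Classical in
/-- The real-valued indicator of a proposition. -/
noncomputable def ind (P : Prop) : ℝ := if P then 1 else 0

theorem ind_nonneg (P : Prop) : 0 ≤ ind P := by unfold ind; split_ifs <;> norm_num

theorem ind_le_one (P : Prop) : ind P ≤ 1 := by unfold ind; split_ifs <;> norm_num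

theorem ind_of_true {P : Prop} (h : P) : ind P = 1 := by simp [ind, h]

theorem ind_of_false {P : Prop} (h : ¬ P) : ind P = 0 := by simp [ind, h]

theorem ind_mono {P Q : Prop} (h : P → Q) : ind P ≤ ind Q := by
  by_cases hP : P
  · rw [ind_of_true hP, ind_of_true (h hP)]
  · rw [ind_of_false hP]; exact ind_nonneg _

theorem ind_or_le (P Q : Prop) : ind (P ∨ Q) ≤ ind P + ind Q := by
  by_cases hP : P
  · rw [ind_of_true (Or.inl hP), ind_of_true hP]; linarith [ind_nonneg Q]
  · by_cases hQ : Q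
    · rw [ind_of_true (Or.inr hQ), ind_of_true hQ]; linarith [ind_nonneg P]
    · rw [ind_of_false (by tauto)]; linarith [ind_nonneg P, ind_nonneg Q]

section wmean
variable {α β : Type*} [Fintype α] [Fintype β]

theorem wmean_mono {p : α → ℝ} (hp : ∀ a, 0 ≤ p a) {f g : α → ℝ} (h : ∀ a, f a ≤ g a) :
    wmean p f ≤ wmean p g :=
  Finset.sum_le_sum fun a _ => mul_le_mul_of_nonneg_left (h a) (hp a)

theorem wmean_nonneg {p : α → ℝ} (hp : ∀ a, 0 ≤ p a) {f : α → ℝ} (h : ∀ a, 0 ≤ f a) :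
    0 ≤ wmean p f :=
  Finset.sum_nonneg fun a _ => mul_nonneg (hp a) (h a)

theorem wmean_add (p : α → ℝ) (f g : α → ℝ) :
    wmean p (fun a => f a + g a) = wmean p f + wmean p g := by
  simp only [wmean, mul_add, Finset.sum_add_distrib]

theorem wmean_sub (p : α → ℝ) (f g : α → ℝ) :
    wmean p (fun a => f a - g a) = wmean p f - wmean p g := by
  simp only [wmean, mul_sub, Finset.sum_sub_distrib]

theorem wmean_const_mul (p : α → ℝ) (c : ℝ) (f : α → ℝ) :
    wmean p (fun a => c * f a) = c * wmean p f := by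
  simp only [wmean, Finset.mul_sum]; exact Finset.sum_congr rfl fun a _ => by ring

theorem wmean_mul_const (p : α → ℝ) (c : ℝ) (f : α → ℝ) :
    wmean p (fun a => f a * c) = wmean p f * c := by
  simp only [wmean, Finset.sum_mul]; exact Finset.sum_congr rfl fun a _ => by ring

theorem wmean_sum {κ : Type*} (p : α → ℝ) (t : Finset κ) (f : κ → α → ℝ) :
    wmean p (fun a => ∑ k ∈ t, f k a) = ∑ k ∈ t, wmean p (f k) := by
  simp only [wmean, Finset.mul_sum]; exact Finset.sum_comm

theorem wmean_comm (p : α → ℝ) (q : β → ℝ) (f : α → β → ℝ) :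
    wmean p (fun a => wmean q (f a)) = wmean q (fun b => wmean p (fun a => f a b)) := by
  simp only [wmean, Finset.mul_sum]
  rw [Finset.sum_comm]
  exact Finset.sum_congr rfl fun b _ => Finset.sum_congr rfl fun a _ => by ring

theorem wmean_const {p : α → ℝ} (hp : IsMass p) (c : ℝ) : wmean p (fun _ => c) = c := by
  simp only [wmean, ← Finset.sum_mul, hp.2, one_mul]

theorem wmean_le_one {p : α → ℝ} (hp : IsMass p) {f : α → ℝ} (h : ∀ a, f a ≤ 1) :
    wmean p f ≤ 1 :=
  (wmean_mono hp.1 h).trans_eq (wmean_const hp 1)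

theorem wmean_sq_le {p : α → ℝ} (hp : IsMass p) (f : α → ℝ) :
    (wmean p f) ^ 2 ≤ wmean p (fun a => f a ^ 2) := by
  have h : 0 ≤ wmean p (fun a => (f a - wmean p f) ^ 2) :=
    wmean_nonneg hp.1 fun a => sq_nonneg _
  have e : wmean p (fun a => (f a - wmean p f) ^ 2)
      = wmean p (fun a => f a ^ 2) - (wmean p f) ^ 2 := by
    have : (fun a => (f a - wmean p f) ^ 2)
        = fun a => (f a ^ 2 - 2 * wmean p f * f a) + (wmean p f) ^ 2 := by funext a; ring
    rw [this, wmean_add, wmean_sub, wmean_const_mul, wmean_const hp]; ring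
  linarith

theorem exists_le_of_wmean_le {p : α → ℝ} (hp : IsMass p) {f : α → ℝ} {B : ℝ}
    (h : wmean p f ≤ B) : ∃ a, f a ≤ B := by
  by_contra hc
  push Not at hc
  have hpos : ∃ a, 0 < p a := by
    by_contra hn
    push Not at hn
    have : ∑ a, p a ≤ 0 := Finset.sum_nonpos fun a _ => hn a
    linarith [hp.2]
  obtain ⟨a₀, ha₀⟩ := hpos
  have : wmean p (fun _ => B) < wmean p f :=
    Finset.sum_lt_sum (fun a _ => mul_le_mul_of_nonneg_left (hc a).le (hp.1 a))
      ⟨a₀, Finset.mem_univ _, mul_lt_mul_of_pos_left (hc a₀) ha₀⟩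
  rw [wmean_const hp] at this
  linarith

/-- A randomized rule can be replaced by a deterministic one without increasing a cost that is a
sum of terms each depending on one decision. -/
theorem exists_deterministic {ι : Type*} [Fintype ι] {K : ι → α → ℝ} (hK : ∀ i, IsMass (K i))
    (G : ι → α → ℝ) : ∃ f : ι → α, ∑ i, G i (f i) ≤ ∑ i, wmean (K i) (G i) := by
  have h : ∀ i, ∃ x, G i x ≤ wmean (K i) (G i) := fun i => exists_le_of_wmean_le (hK i) le_rfl
  choose f hf using h
  exact ⟨f, Finset.sum_le_sum fun i _ => hf i⟩

end wmean

/-! ### I.i.d. families -/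

section iid
variable {ι α : Type*} [Fintype ι] [DecidableEq ι] [Fintype α]

theorem isMass_iid {p : α → ℝ} (hp : IsMass p) : IsMass (iidMass p : (ι → α) → ℝ) := by
  refine ⟨fun C => Finset.prod_nonneg fun i _ => hp.1 _, ?_⟩
  unfold iidMass
  rw [← Fintype.prod_sum (fun (_ : ι) a => p a)]
  simp [hp.2]

theorem wmean_iid_single {p : α → ℝ} (hp : IsMass p) (i : ι) (f : α → ℝ) :
    wmean (iidMass p) (fun C : ι → α => f (C i)) = wmean p f := by
  unfold wmean iidMass
  have h : ∀ C : ι → α, (∏ j, p (C j)) * f (C i)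
      = ∏ j, (p (C j) * if j = i then f (C j) else 1) := by
    intro C
    rw [Finset.prod_mul_distrib]; simp
  simp_rw [h]
  rw [← Fintype.prod_sum (fun (j : ι) a => p a * if j = i then f a else 1)]
  rw [Finset.prod_eq_single i]
  · simp
  · intro j _ hj; simp [hj, hp.2]
  · simp

theorem wmean_iid_mul {p : α → ℝ} (hp : IsMass p) {i j : ι} (hij : i ≠ j) (f g : α → ℝ) :
    wmean (iidMass p) (fun C : ι → α => f (C i) * g (C j)) = wmean p f * wmean p g := by
  unfold wmean iidMass
  have h : ∀ C : ι → α, (∏ k, p (C k)) * (f (C i) * g (C j))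
      = ∏ k, (p (C k) * ((if k = i then f (C k) else 1) * (if k = j then g (C k) else 1))) := by
    intro C
    rw [Finset.prod_mul_distrib, Finset.prod_mul_distrib]; simp
  simp_rw [h]
  rw [← Fintype.prod_sum (fun (k : ι) a =>
    p a * ((if k = i then f a else 1) * (if k = j then g a else 1)))]
  rw [Finset.prod_eq_mul i j hij]
  · simp [hij, hij.symm]
  · intro k _ hk; simp [hk.1, hk.2, hp.2]
  · simp
  · simp

theorem wmean_iid_pair {p : α → ℝ} (hp : IsMass p) {i j : ι} (hij : i ≠ j) (f : α → α → ℝ) :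
    wmean (iidMass p) (fun C : ι → α => f (C i) (C j))
      = wmean p (fun a => wmean p (fun b => f a b)) := by
  classical
  -- Splitting by the value of `C i` writes `f` as a sum of products of one-coordinate functions, to
  -- which independence applies.
  have h : ∀ C : ι → α, f (C i) (C j)
      = ∑ a, (fun x => if x = a then (1 : ℝ) else 0) (C i) * f a (C j) := by
    intro C; simp
  simp_rw [h]
  rw [wmean_sum]
  have h' : ∀ a, wmean (iidMass p) (fun C : ι → α =>
      (fun x => if x = a then (1 : ℝ) else 0) (C i) * f a (C j))
      = wmean p (fun x => if x = a then (1 : ℝ) else 0) * wmean p (f a) :=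
    fun a => wmean_iid_mul hp hij (fun x => if x = a then (1 : ℝ) else 0) (f a)
  rw [Finset.sum_congr rfl fun a _ => h' a]
  unfold wmean
  exact Finset.sum_congr rfl fun a _ => by simp

/-- Distinct coordinates are independent and centred, so the cross terms vanish. The injection `e`
selects a subfamily, such as the codewords of one message inside the whole codebook. -/
theorem wmean_iid_sq_sum {κ : Type*} [Fintype κ] {p : α → ℝ} (hp : IsMass p) {e : κ → ι}
    (he : Function.Injective e) {f : α → ℝ} (hf : wmean p f = 0) :
    wmean (iidMass p) (fun C : ι → α => (∑ k, f (C (e k))) ^ 2)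
      = Fintype.card κ * wmean p (fun a => f a ^ 2) := by
  classical
  simp_rw [sq, Finset.sum_mul_sum]
  rw [wmean_sum]
  simp_rw [wmean_sum]
  have h : ∀ k l : κ, wmean (iidMass p) (fun C : ι → α => f (C (e k)) * f (C (e l)))
      = if k = l then wmean p (fun a => f a * f a) else 0 := by
    intro k l
    split_ifs with hkl
    · subst hkl
      exact wmean_iid_single hp (e k) (fun a => f a * f a)
    · rw [wmean_iid_mul hp (fun h => hkl (he h)), hf, zero_mul]
  simp_rw [h]
  simp

/-- Chebyshev's inequality for an i.i.d. family. -/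
theorem wmean_iid_deviation [Nonempty ι] {p : α → ℝ} (hp : IsMass p) (f : α → ℝ) {δ : ℝ} (hδ : 0 < δ) :
    wmean (iidMass p) (fun C : ι → α => ind (δ * Fintype.card ι ≤
        |∑ i, f (C i) - Fintype.card ι * wmean p f|))
      ≤ wmean p (fun a => (f a - wmean p f) ^ 2) / (δ ^ 2 * Fintype.card ι) := by
  set n : ℝ := (Fintype.card ι : ℝ) with hn
  set σ := wmean p (fun a => (f a - wmean p f) ^ 2) with hσ
  have hpos : 0 < n := by rw [hn]; exact_mod_cast Fintype.card_pos
  have h0 : wmean p (fun a => f a - wmean p f) = 0 := by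
    rw [wmean_sub, wmean_const hp, sub_self]
  have hv := wmean_iid_sq_sum (ι := ι) hp Function.injective_id h0
  rw [← hn, ← hσ] at hv
  have hle : ∀ C : ι → α, ind (δ * n ≤ |∑ i, f (C i) - n * wmean p f|)
      ≤ (1 / (δ * n) ^ 2) * (∑ k, (f (C (id k)) - wmean p f)) ^ 2 := by
    intro C
    have e : ∑ k, (f (C (id k)) - wmean p f) = ∑ i, f (C i) - n * wmean p f := by
      simp [Finset.sum_sub_distrib, hn]
    rw [e]
    by_cases hc : δ * n ≤ |∑ i, f (C i) - n * wmean p f|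
    · rw [ind_of_true hc, ← sq_abs (∑ i, f (C i) - n * wmean p f), one_div_mul_eq_div,
        le_div_iff₀ (by positivity), one_mul]
      exact pow_le_pow_left₀ (by positivity) hc 2
    · rw [ind_of_false hc]; positivity
  refine (wmean_mono (isMass_iid hp).1 hle).trans_eq ?_
  rw [wmean_const_mul, hv]
  field_simp

end iid

/-! ### The likelihood encoder and soft covering -/

section covering

open Classical in
/-- The distribution of a likelihood encoder: index `k` has probability proportional to `r k`. -/
noncomputable def likelihood {κ : Type*} [Fintype κ] (r : κ → ℝ) (k : κ) : ℝ :=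
  if ∑ j, r j = 0 then 1 / Fintype.card κ else r k / ∑ j, r j

variable {κ : Type*} [Fintype κ]

theorem isMass_likelihood [Nonempty κ] {r : κ → ℝ} (hr : ∀ k, 0 ≤ r k) :
    IsMass (likelihood r) := by
  unfold likelihood
  refine ⟨fun k => ?_, ?_⟩
  · split_ifs
    · positivity
    · exact div_nonneg (hr k) (Finset.sum_nonneg fun j _ => hr j)
  · split_ifs with h
    · simp
    · rw [← Finset.sum_div, div_self h]

/-- Both families are multiples of `r`, so the ℓ¹ distance is the distance of the two factors times
the total weight. If all weights vanish, the uniform default in `likelihood` makes both sides equal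
to 1. -/
theorem sum_abs_likelihood_sub [Nonempty κ] {r : κ → ℝ} (hr : ∀ k, 0 ≤ r k) :
    ∑ k, |likelihood r k - r k / Fintype.card κ| = |1 - (∑ k, r k) / Fintype.card κ| := by
  unfold likelihood
  split_ifs with h
  · have : ∀ k, r k = 0 := fun k =>
      (Finset.sum_eq_zero_iff_of_nonneg fun j _ => hr j).1 h k (Finset.mem_univ k)
    simp [this]
  · have hpos : 0 < ∑ j, r j := lt_of_le_of_ne (Finset.sum_nonneg fun j _ => hr j) (Ne.symm h)
    have e : ∀ k, |r k / ∑ j, r j - r k / Fintype.card κ|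
        = r k * |1 / ∑ j, r j - 1 / (Fintype.card κ : ℝ)| := by
      intro k
      rw [← abs_of_nonneg (hr k), ← abs_mul, abs_of_nonneg (hr k)]
      congr 1; ring
    simp_rw [e]
    rw [← Finset.sum_mul]
    nth_rewrite 1 [← abs_of_pos hpos]
    rw [← abs_mul]
    congr 1
    field_simp

variable {ι α : Type*} [Fintype ι] [DecidableEq ι] [Fintype α]

/-- Soft covering: the average of the density of `a` with respect to `p` over an i.i.d. `p`
codebook is close to `1`. -/
theorem soft_covering [Nonempty κ] {p a : α → ℝ} (hp : IsMass p) (ha : IsMass a)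
    (hac : ∀ x, p x = 0 → a x = 0) {e : κ → ι} (he : Function.Injective e) {θ : ℝ} (hθ : 0 ≤ θ) :
    wmean (iidMass p) (fun C : ι → α => |1 - (∑ k, a (C (e k)) / p (C (e k))) / Fintype.card κ|)
      ≤ 2 * wmean a (fun x => ind (θ < a x / p x)) + √(θ / Fintype.card κ) := by
  set L : ℝ := (Fintype.card κ : ℝ) with hL
  have hLpos : 0 < L := by rw [hL]; exact_mod_cast Fintype.card_pos
  set r : α → ℝ := fun x => a x / p x with hr
  -- Truncation of the density at `θ`: the bounded part `g` has a small variance, and the tail `h`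
  -- has mean equal to the probability under `a` that the density exceeds `θ`.
  set h : α → ℝ := fun x => r x * ind (θ < r x) with hh
  set g : α → ℝ := fun x => r x - h x with hg
  have hr0 : ∀ x, 0 ≤ r x := fun x => div_nonneg (ha.1 x) (hp.1 x)
  have hh0 : ∀ x, 0 ≤ h x := fun x => mul_nonneg (hr0 x) (ind_nonneg _)
  have hg0 : ∀ x, 0 ≤ g x := fun x => by
    have := mul_le_mul_of_nonneg_left (ind_le_one (θ < r x)) (hr0 x)
    simp only [hg, hh]; linarith
  have hgθ : ∀ x, g x ≤ θ := fun x => by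
    simp only [hg, hh]
    by_cases hc : θ < r x
    · rw [ind_of_true hc]; linarith
    · rw [ind_of_false hc]; linarith
  have hpr : ∀ x, p x * r x = a x := fun x => by
    by_cases hx : p x = 0
    · rw [hx, hac x hx, zero_mul]
    · simp only [hr]; field_simp
  have hmr : wmean p r = 1 := by
    unfold wmean; simp_rw [hpr]; exact ha.2
  have hmh : wmean p h = wmean a (fun x => ind (θ < a x / p x)) := by
    unfold wmean
    exact Finset.sum_congr rfl fun x _ => by simp only [hh, ← mul_assoc, hpr]; rfl
  have hmg : wmean p g = 1 - wmean p h := by simp only [hg]; rw [wmean_sub, hmr]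
  have hmg1 : wmean p g ≤ 1 := by
    rw [hmg]; linarith [wmean_nonneg hp.1 hh0]
  set m := wmean p g with hm
  -- Since `m` is 1 minus the mean of `h`, the tail enters twice, once through its mean and once
  -- through its empirical average. Hence the factor 2 in the bound.
  have key : ∀ C : ι → α, |1 - (∑ k, r (C (e k))) / L|
      ≤ |(∑ k, (g (C (e k)) - m)) / L| + wmean p h + (1 / L) * ∑ k, h (C (e k)) := by
    intro C
    have e1 : 1 - (∑ k, r (C (e k))) / L
        = (-((∑ k, (g (C (e k)) - m)) / L) + wmean p h) + -((1 / L) * ∑ k, h (C (e k))) := by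
      have : ∑ k, r (C (e k)) = ∑ k, (g (C (e k)) - m) + L * m + ∑ k, h (C (e k)) := by
        rw [Finset.sum_sub_distrib]
        simp only [Finset.sum_const, Finset.card_univ, nsmul_eq_mul, ← hL]
        rw [sub_add_cancel, ← Finset.sum_add_distrib]
        exact Finset.sum_congr rfl fun k _ => by simp only [hg]; ring
      rw [this, hmg]
      field_simp
      ring
    rw [e1]
    refine (abs_add_le _ _).trans (add_le_add ((abs_add_le _ _).trans (add_le_add ?_ ?_)) ?_)
    · rw [abs_neg]
    · rw [abs_of_nonneg (wmean_nonneg hp.1 hh0)]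
    · rw [abs_neg, abs_of_nonneg]
      exact mul_nonneg (by positivity) (Finset.sum_nonneg fun k _ => hh0 _)
  have hI := isMass_iid (ι := ι) hp
  refine (wmean_mono hI.1 key).trans ?_
  rw [wmean_add, wmean_add, wmean_const hI, wmean_const_mul, wmean_sum]
  simp_rw [wmean_iid_single hp]
  simp only [Finset.sum_const, Finset.card_univ, nsmul_eq_mul, ← hL]
  have hsq : wmean (iidMass p) (fun C : ι → α => |(∑ k, (g (C (e k)) - m)) / L|)
      ≤ √(θ / L) := by
    apply Real.le_sqrt_of_sq_le
    refine (wmean_sq_le hI _).trans ?_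
    have h0 : wmean p (fun x => g x - m) = 0 := by
      rw [wmean_sub, wmean_const hp, sub_self]
    have e2 : (fun C : ι → α => |(∑ k, (g (C (e k)) - m)) / L| ^ 2)
        = fun C => (1 / L ^ 2) * (∑ k, (g (C (e k)) - m)) ^ 2 := by
      funext C; rw [sq_abs]; ring
    rw [e2, wmean_const_mul, wmean_iid_sq_sum hp he h0, ← hL]
    -- The variance is at most the second moment, and g² ≤ θ g with g of mean at most 1.
    have e3 : wmean p (fun x => (g x - m) ^ 2) ≤ θ := by
      have e4 : (fun x => (g x - m) ^ 2) = fun x => (g x ^ 2 - 2 * m * g x) + m ^ 2 := by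
        funext x; ring
      rw [e4, wmean_add, wmean_sub, wmean_const_mul, wmean_const hp, ← hm]
      have e5 : wmean p (fun x => g x ^ 2) ≤ wmean p (fun x => θ * g x) :=
        wmean_mono hp.1 fun x => by nlinarith [hg0 x, hgθ x]
      rw [wmean_const_mul, ← hm] at e5
      nlinarith [sq_nonneg m]
    calc 1 / L ^ 2 * (L * wmean p (fun x => (g x - m) ^ 2))
        = wmean p (fun x => (g x - m) ^ 2) / L := by field_simp
      _ ≤ θ / L := by gcongr
  rw [hmh]
  have : 1 / L * (L * wmean a (fun x => ind (θ < a x / p x)))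
      = wmean a (fun x => ind (θ < a x / p x)) := by field_simp
  linarith

end covering

/-! ### Derandomization -/

section derandomize
variable {I J S A B : Type*} [Fintype I] [Fintype J] [Fintype S] [Fintype A] [Fintype B]

theorem wmean_mass_mul (p : A → ℝ) (q : A → B → ℝ) (f : A → B → ℝ) :
    wmean (fun x : A × B => p x.1 * q x.1 x.2) (fun x => f x.1 x.2)
      = wmean p (fun a => wmean (q a) (f a)) := by
  simp only [wmean, Fintype.sum_prod_type, Finset.mul_sum, mul_assoc]

theorem IsMass.mul {p : A → ℝ} {q : A → B → ℝ} (hp : IsMass p) (hq : ∀ a, IsMass (q a)) :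
    IsMass (fun x : A × B => p x.1 * q x.1 x.2) := by
  refine ⟨fun x => mul_nonneg (hp.1 _) ((hq _).1 _), ?_⟩
  rw [Fintype.sum_prod_type]
  simp only [← Finset.mul_sum, (hq _).2, mul_one, hp.2]

/-- Two randomized rules with independent randomness can both be made deterministic. -/
theorem exists_deterministic_pair {K₁ : I → S → A → ℝ} {K₂ : J → S → B → ℝ}
    (h₁ : ∀ i s, IsMass (K₁ i s)) (h₂ : ∀ j s, IsMass (K₂ j s)) (p : S → ℝ)
    (G : S → I → J → A → B → ℝ) :
    ∃ (f₁ : I → S → A) (f₂ : J → S → B),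
      ∑ i, ∑ j, wmean p (fun s => G s i j (f₁ i s) (f₂ j s))
        ≤ ∑ i, ∑ j, wmean p (fun s => wmean (K₁ i s) fun a => wmean (K₂ j s) fun b =>
            G s i j a b) := by
  -- The first rule is fixed against the average over the second, then the second against the fixed
  -- `f₁`. At each stage the cost is a sum over (message, state) of terms that involve a single
  -- decision.
  obtain ⟨f₁, hf₁⟩ := exists_deterministic (K := fun x : I × S => K₁ x.1 x.2)
    (fun x => h₁ x.1 x.2)
    (fun x a => p x.2 * ∑ j, wmean (K₂ j x.2) fun b => G x.2 x.1 j a b)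
  obtain ⟨f₂, hf₂⟩ := exists_deterministic (K := fun x : J × S => K₂ x.1 x.2)
    (fun x => h₂ x.1 x.2)
    (fun x b => p x.2 * ∑ i, G x.2 i x.1 (f₁ (i, x.2)) b)
  refine ⟨fun i s => f₁ (i, s), fun j s => f₂ (j, s), ?_⟩
  simp only [wmean_const_mul, wmean_sum, Fintype.sum_prod_type] at hf₁ hf₂
  have e₁ : ∑ i, ∑ s, p s * ∑ j, wmean (K₂ j s) (fun b => G s i j (f₁ (i, s)) b)
      = ∑ j, ∑ s, p s * ∑ i, wmean (K₂ j s) (fun b => G s i j (f₁ (i, s)) b) := by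
    simp only [Finset.mul_sum]
    rw [Finset.sum_comm, Finset.sum_comm (s := (Finset.univ : Finset J))]
    exact Finset.sum_congr rfl fun s _ => Finset.sum_comm
  have e₂ : ∑ j, ∑ s, p s * ∑ i, G s i j (f₁ (i, s)) (f₂ (j, s))
      = ∑ i, ∑ j, wmean p (fun s => G s i j (f₁ (i, s)) (f₂ (j, s))) := by
    simp only [wmean, Finset.mul_sum]
    rw [Finset.sum_comm (s := (Finset.univ : Finset I))]
    exact Finset.sum_congr rfl fun s _ => Finset.sum_comm
  have e₃ : ∑ i, ∑ s, p s * ∑ j, wmean (K₁ i s) (fun a => wmean (K₂ j s) fun b => G s i j a b)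
      = ∑ i, ∑ j, wmean p (fun s => wmean (K₁ i s) fun a => wmean (K₂ j s) fun b =>
            G s i j a b) := by
    refine Finset.sum_congr rfl fun i _ => ?_
    conv_rhs => simp only [wmean.eq_def p]
    simp only [Finset.mul_sum]
    exact Finset.sum_comm
  rw [← e₂, ← e₃]
  exact hf₂.trans (e₁ ▸ hf₁)

end derandomize

/-! ### Threshold decoding -/

section decode
variable {M K J α β : Type*}

open Classical in
/-- The decoder that outputs some message having a codeword that passes the test `A` together with
some codeword of the other user. -/
noncomputable def scanDecode [Nonempty M] (A : α → β → Prop) (C : M × K → α) (D : J → β) : M :=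
  if h : ∃ w, ∃ k j, A (C (w, k)) (D j) then h.choose else Classical.arbitrary M

/-- If the true pair passes the test, the decoder outputs a message that passes, so an error
exhibits a codeword of a wrong message passing with the true codeword of the other user or with
another one. A wrong index of the true message does no harm, so only indices with first component
different from `w` are summed. -/
theorem ind_scanDecode_ne_le [Nonempty M] [Fintype M] [Fintype K] [Fintype J] [DecidableEq M]
    [DecidableEq J] (A : α → β → Prop) (C : M × K → α) (D : J → β) (w : M) (k : K) (j : J) :
    ind (scanDecode A C D ≠ w) ≤ ind (¬ A (C (w, k)) (D j))
      + ∑ i' ∈ Finset.univ.filter (fun i' : M × K => i'.1 ≠ w), ind (A (C i') (D j))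
      + ∑ i' ∈ Finset.univ.filter (fun i' : M × K => i'.1 ≠ w),
          ∑ j' ∈ Finset.univ.filter (fun j' => j' ≠ j), ind (A (C i') (D j')) := by
  have n₂ : 0 ≤ ∑ i' ∈ Finset.univ.filter (fun i' : M × K => i'.1 ≠ w), ind (A (C i') (D j)) :=
    Finset.sum_nonneg fun _ _ => ind_nonneg _
  have n₃ : 0 ≤ ∑ i' ∈ Finset.univ.filter (fun i' : M × K => i'.1 ≠ w),
      ∑ j' ∈ Finset.univ.filter (fun j' => j' ≠ j), ind (A (C i') (D j')) :=
    Finset.sum_nonneg fun _ _ => Finset.sum_nonneg fun _ _ => ind_nonneg _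
  by_cases hw : scanDecode A C D = w
  · rw [ind_of_false (by simpa using hw)]
    linarith [ind_nonneg (¬ A (C (w, k)) (D j))]
  rw [ind_of_true hw]
  by_cases hA : A (C (w, k)) (D j)
  · have h : ∃ w, ∃ k j, A (C (w, k)) (D j) := ⟨w, k, j, hA⟩
    obtain ⟨k', j', hA'⟩ := h.choose_spec
    have hd : scanDecode A C D = h.choose := by unfold scanDecode; rw [dif_pos h]
    rw [← hd] at hA'
    have hmem : (scanDecode A C D, k') ∈ Finset.univ.filter (fun i' : M × K => i'.1 ≠ w) := by
      simpa using hw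
    by_cases hj : j' = j
    · subst hj
      have := Finset.single_le_sum (f := fun i' => ind (A (C i') (D j')))
        (fun _ _ => ind_nonneg _) hmem
      simp only [ind_of_true hA'] at this
      linarith [ind_nonneg (¬ A (C (w, k)) (D j'))]
    · have h₁ := Finset.single_le_sum (f := fun i' =>
        ∑ j' ∈ Finset.univ.filter (fun j' => j' ≠ j), ind (A (C i') (D j')))
        (fun _ _ => Finset.sum_nonneg fun _ _ => ind_nonneg _) hmem
      have h₂ := Finset.single_le_sum
        (f := fun j' => ind (A (C (scanDecode A C D, k')) (D j')))
        (s := Finset.univ.filter (fun j' => j' ≠ j))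
        (fun _ _ => ind_nonneg _) (a := j') (by simpa using hj)
      simp only [ind_of_true hA'] at h₂
      linarith [ind_nonneg (¬ A (C (w, k)) (D j))]
  · rw [ind_of_true hA]; linarith

end decode

/-! ### Replacing likelihood encoders by the ideal density -/

/-- The two laws are replaced in turn, each at the cost of an ℓ¹ distance because 0 ≤ `e` ≤ 1. The
unnormalized weights `r k / card κ` need not sum to 1, so their total multiplies the second cost; it
has mean 1 over the codebook. -/
theorem likelihood_pair_le {κ μ : Type*} [Fintype κ] [Fintype μ] [Nonempty κ] [Nonempty μ]
    {r : κ → ℝ} {t : μ → ℝ} (hr : ∀ k, 0 ≤ r k) (ht : ∀ l, 0 ≤ t l) {e : κ → μ → ℝ}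
    (he₀ : ∀ k l, 0 ≤ e k l) (he₁ : ∀ k l, e k l ≤ 1) :
    wmean (likelihood r) (fun k => wmean (likelihood t) (e k))
      ≤ (∑ k, ∑ l, r k / Fintype.card κ * (t l / Fintype.card μ) * e k l)
        + |1 - (∑ k, r k) / Fintype.card κ|
        + (∑ k, r k) / Fintype.card κ * |1 - (∑ l, t l) / Fintype.card μ| := by
  set a := likelihood r with ha
  set b := likelihood t with hb
  set a' : κ → ℝ := fun k => r k / Fintype.card κ with ha'
  set b' : μ → ℝ := fun l => t l / Fintype.card μ with hb'
  have hma := isMass_likelihood hr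
  have hmb := isMass_likelihood ht
  have ha0 : ∀ k, 0 ≤ a' k := fun k => div_nonneg (hr k) (Nat.cast_nonneg _)
  have hab : ∀ k, wmean b (e k) ≤ (∑ l, b' l * e k l) + ∑ l, |b l - b' l| := by
    intro k
    unfold wmean
    rw [← Finset.sum_add_distrib]
    refine Finset.sum_le_sum fun l _ => ?_
    have h₁ : (b l - b' l) * e k l ≤ |b l - b' l| :=
      (mul_le_mul_of_nonneg_right (le_abs_self _) (he₀ k l)).trans
        (mul_le_of_le_one_right (abs_nonneg _) (he₁ k l))
    linarith
  have hb1 : ∀ k, wmean b (e k) ≤ 1 := fun k => wmean_le_one hmb (he₁ k)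
  have hb0 : ∀ k, 0 ≤ wmean b (e k) := fun k => wmean_nonneg hmb.1 (he₀ k)
  have h₁ : wmean a (fun k => wmean b (e k))
      ≤ (∑ k, a' k * wmean b (e k)) + ∑ k, |a k - a' k| := by
    rw [← Finset.sum_add_distrib]
    refine Finset.sum_le_sum fun k _ => ?_
    have h₁ : (a k - a' k) * wmean b (e k) ≤ |a k - a' k| :=
      (mul_le_mul_of_nonneg_right (le_abs_self _) (hb0 k)).trans
        (mul_le_of_le_one_right (abs_nonneg _) (hb1 k))
    linarith
  have h₂ : ∑ k, a' k * wmean b (e k)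
      ≤ ∑ k, a' k * ((∑ l, b' l * e k l) + ∑ l, |b l - b' l|) :=
    Finset.sum_le_sum fun k _ => mul_le_mul_of_nonneg_left (hab k) (ha0 k)
  have e₁ : ∑ k, |a k - a' k| = |1 - (∑ k, r k) / Fintype.card κ| := sum_abs_likelihood_sub hr
  have e₂ : ∑ l, |b l - b' l| = |1 - (∑ l, t l) / Fintype.card μ| := sum_abs_likelihood_sub ht
  rw [e₁] at h₁
  rw [e₂] at h₂
  simp only [mul_add, Finset.sum_add_distrib, ← Finset.sum_mul] at h₂
  rw [show ∑ k, a' k = (∑ k, r k) / Fintype.card κ from (Finset.sum_div _ _ _).symm] at h₂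
  have e₃ : ∑ k, a' k * ∑ l, b' l * e k l = ∑ k, ∑ l, a' k * b' l * e k l := by
    simp only [Finset.mul_sum, mul_assoc]
  rw [e₃] at h₂
  linarith

/-! ### The one-shot coding theorem -/

/-- A single use of a two-user interference channel with state `s`, known at the encoders,
auxiliary variables `u`, `v` generated from `s`, and inputs generated from these. -/
structure CodingModel (S U V X₁ X₂ Y₁ Y₂ : Type*) [Fintype S] [Fintype U] [Fintype V]
    [Fintype X₁] [Fintype X₂] [Fintype Y₁] [Fintype Y₂] where
  pS : S → ℝ
  a : S → U → ℝ
  b : S → V → ℝ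
  q₁ : S → U → X₁ → ℝ
  q₂ : S → V → X₂ → ℝ
  W : S → X₁ → X₂ → Y₁ × Y₂ → ℝ
  isMass_pS : IsMass pS
  isMass_a : ∀ s, IsMass (a s)
  isMass_b : ∀ s, IsMass (b s)
  isMass_q₁ : ∀ s u, IsMass (q₁ s u)
  isMass_q₂ : ∀ s v, IsMass (q₂ s v)
  isMass_W : ∀ s x₁ x₂, IsMass (W s x₁ x₂)

/-- The marginal of the output of a kernel. -/
noncomputable def kernelMarginal {S U : Type*} [Fintype S] (p : S → ℝ) (a : S → U → ℝ)
    (u : U) : ℝ := wmean p (fun s => a s u)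

section kernel
variable {S U : Type*} [Fintype S] [Fintype U] {p : S → ℝ} {a : S → U → ℝ}

theorem isMass_kernelMarginal (hp : IsMass p) (ha : ∀ s, IsMass (a s)) :
    IsMass (kernelMarginal p a) := by
  refine ⟨fun u => wmean_nonneg hp.1 fun s => (ha s).1 u, ?_⟩
  unfold kernelMarginal
  rw [← wmean_sum]
  simp only [(ha _).2]
  exact wmean_const hp 1

theorem kernel_eq_zero_of_marginal (hp : IsMass p) (ha : ∀ s, IsMass (a s)) {s : S}
    (hs : p s ≠ 0) {u : U} (hu : kernelMarginal p a u = 0) : a s u = 0 := by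
  have := (Finset.sum_eq_zero_iff_of_nonneg
    (fun s _ => mul_nonneg (hp.1 s) ((ha s).1 u))).1 hu s (Finset.mem_univ s)
  simpa [hs] using this

/-- Change of measure from the marginal to the kernel. Where the marginal vanishes so does the
kernel, provided that the state has positive probability; this is why the states of mass zero are
excluded. -/
theorem wmean_marginal_density (hp : IsMass p) (ha : ∀ s, IsMass (a s)) {s : S}
    (hs : p s ≠ 0) (f : U → ℝ) :
    wmean (kernelMarginal p a) (fun u => a s u / kernelMarginal p a u * f u)
      = wmean (a s) f := by
  refine Finset.sum_congr rfl fun u _ => ?_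
  by_cases hu : kernelMarginal p a u = 0
  · rw [hu, kernel_eq_zero_of_marginal hp ha hs hu]; simp
  · field_simp

theorem wmean_congr_of_ne_zero {f g : S → ℝ} (h : ∀ s, p s ≠ 0 → f s = g s) :
    wmean p f = wmean p g := by
  refine Finset.sum_congr rfl fun s _ => ?_
  by_cases hs : p s = 0
  · simp [hs]
  · rw [h s hs]

theorem wmean_le_of_ne_zero (hp : ∀ s, 0 ≤ p s) {f g : S → ℝ} (h : ∀ s, p s ≠ 0 → f s ≤ g s) :
    wmean p f ≤ wmean p g := by
  refine Finset.sum_le_sum fun s _ => ?_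
  by_cases hs : p s = 0
  · simp [hs]
  · exact mul_le_mul_of_nonneg_left (h s hs) (hp s)

end kernel

namespace CodingModel

variable {S U V X₁ X₂ Y₁ Y₂ : Type*} [Fintype S] [Fintype U] [Fintype V]
    [Fintype X₁] [Fintype X₂] [Fintype Y₁] [Fintype Y₂] (m : CodingModel S U V X₁ X₂ Y₁ Y₂)

/-- The marginal law of `u`. -/
noncomputable def pU : U → ℝ := kernelMarginal m.pS m.a

/-- The marginal law of `v`. -/
noncomputable def pV : V → ℝ := kernelMarginal m.pS m.b

theorem isMass_pU : IsMass m.pU := isMass_kernelMarginal m.isMass_pS m.isMass_a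

theorem isMass_pV : IsMass m.pV := isMass_kernelMarginal m.isMass_pS m.isMass_b

/-- The expectation over the outputs, given the state and the auxiliary variables. -/
noncomputable def out (s : S) (u : U) (v : V) (φ : Y₁ × Y₂ → ℝ) : ℝ :=
  wmean (m.q₁ s u) fun x₁ => wmean (m.q₂ s v) fun x₂ => wmean (m.W s x₁ x₂) φ

/-- The expectation under the joint law. -/
noncomputable def joint (F : S → U → V → Y₁ × Y₂ → ℝ) : ℝ :=
  wmean m.pS fun s => wmean (m.a s) fun u => wmean (m.b s) fun v => m.out s u v (F s u v)

/-- Integral against the density of the joint law with respect to independent `u` and `v`. -/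
noncomputable def dens (u : U) (v : V) (φ : Y₁ × Y₂ → ℝ) : ℝ :=
  wmean m.pS fun s => m.a s u / m.pU u * (m.b s v / m.pV v) * m.out s u v φ

theorem out_mono (s : S) (u : U) (v : V) {φ ψ : Y₁ × Y₂ → ℝ} (h : ∀ y, φ y ≤ ψ y) :
    m.out s u v φ ≤ m.out s u v ψ :=
  wmean_mono (m.isMass_q₁ s u).1 fun x₁ => wmean_mono (m.isMass_q₂ s v).1 fun x₂ =>
    wmean_mono (m.isMass_W s x₁ x₂).1 h

theorem out_const (s : S) (u : U) (v : V) (c : ℝ) : m.out s u v (fun _ => c) = c := by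
  unfold out
  simp only [wmean_const (m.isMass_W s _ _), wmean_const (m.isMass_q₂ s v),
    wmean_const (m.isMass_q₁ s u)]

theorem out_add (s : S) (u : U) (v : V) (φ ψ : Y₁ × Y₂ → ℝ) :
    m.out s u v (fun y => φ y + ψ y) = m.out s u v φ + m.out s u v ψ := by
  simp only [out, wmean_add]

theorem out_sum {κ : Type*} (t : Finset κ) (s : S) (u : U) (v : V) (φ : κ → Y₁ × Y₂ → ℝ) :
    m.out s u v (fun y => ∑ k ∈ t, φ k y) = ∑ k ∈ t, m.out s u v (φ k) := by
  simp only [out, wmean_sum]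

theorem density_nonneg (s : S) (u : U) : 0 ≤ m.a s u / m.pU u :=
  div_nonneg ((m.isMass_a s).1 u) (m.isMass_pU.1 u)

theorem density_nonneg' (s : S) (v : V) : 0 ≤ m.b s v / m.pV v :=
  div_nonneg ((m.isMass_b s).1 v) (m.isMass_pV.1 v)

theorem dens_mono (u : U) (v : V) {φ ψ : Y₁ × Y₂ → ℝ} (h : ∀ y, φ y ≤ ψ y) :
    m.dens u v φ ≤ m.dens u v ψ :=
  wmean_mono m.isMass_pS.1 fun s => mul_le_mul_of_nonneg_left (m.out_mono s u v h)
    (mul_nonneg (m.density_nonneg s u) (m.density_nonneg' s v))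

theorem dens_add (u : U) (v : V) (φ ψ : Y₁ × Y₂ → ℝ) :
    m.dens u v (fun y => φ y + ψ y) = m.dens u v φ + m.dens u v ψ := by
  simp only [dens, out_add, mul_add, wmean_add]

theorem dens_sum {κ : Type*} (t : Finset κ) (u : U) (v : V) (φ : κ → Y₁ × Y₂ → ℝ) :
    m.dens u v (fun y => ∑ k ∈ t, φ k y) = ∑ k ∈ t, m.dens u v (φ k) := by
  simp only [dens, out_sum, Finset.mul_sum, wmean_sum]

/-- The density weights tilt the independent letters u and v into the kernels given the common
state, so the integral of `dens` is an expectation under the joint law. -/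
theorem wmean_dens (φ : U → V → Y₁ × Y₂ → ℝ) :
    wmean m.pU (fun u => wmean m.pV fun v => m.dens u v (φ u v))
      = m.joint fun _ u v => φ u v := by
  unfold dens joint
  simp_rw [wmean_comm m.pV m.pS]
  rw [wmean_comm m.pU m.pS]
  refine wmean_congr_of_ne_zero fun s hs => ?_
  rw [← wmean_marginal_density m.isMass_pS m.isMass_a hs]
  refine congrArg (wmean m.pU) (funext fun u => ?_)
  rw [← wmean_marginal_density m.isMass_pS m.isMass_b hs, ← wmean_const_mul]
  refine congrArg (wmean m.pV) (funext fun v => ?_)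
  rw [← mul_assoc]; rfl

theorem joint_fst (F : S → U → ℝ) :
    m.joint (fun s u _ _ => F s u) = wmean m.pS fun s => wmean (m.a s) (F s) := by
  unfold joint
  simp only [out_const, wmean_const (m.isMass_b _)]

theorem joint_snd (F : S → V → ℝ) :
    m.joint (fun s _ v _ => F s v) = wmean m.pS fun s => wmean (m.b s) (F s) := by
  unfold joint
  simp only [out_const, wmean_const (m.isMass_a _)]

/-! ### Averages over random codebooks -/

section codebook
variable {I J : Type*} [Fintype I] [Fintype J] [DecidableEq I] [DecidableEq J]

/-- Expectation over two independent i.i.d. codebooks. -/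
noncomputable def codeMean (F : (I → U) → (J → V) → ℝ) : ℝ :=
  wmean (iidMass m.pU) fun C => wmean (iidMass m.pV) fun D => F C D

theorem codeMean_mono {F G : (I → U) → (J → V) → ℝ} (h : ∀ C D, F C D ≤ G C D) :
    m.codeMean F ≤ m.codeMean G :=
  wmean_mono (isMass_iid m.isMass_pU).1 fun C => wmean_mono (isMass_iid m.isMass_pV).1 (h C)

theorem codeMean_add (F G : (I → U) → (J → V) → ℝ) :
    m.codeMean (fun C D => F C D + G C D) = m.codeMean F + m.codeMean G := by
  simp only [codeMean, wmean_add]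

theorem codeMean_sum {κ : Type*} (t : Finset κ) (F : κ → (I → U) → (J → V) → ℝ) :
    m.codeMean (fun C D => ∑ k ∈ t, F k C D) = ∑ k ∈ t, m.codeMean (F k) := by
  simp only [codeMean, wmean_sum]

theorem codeMean_const_mul (c : ℝ) (F : (I → U) → (J → V) → ℝ) :
    m.codeMean (fun C D => c * F C D) = c * m.codeMean F := by
  simp only [codeMean, wmean_const_mul]

theorem codeMean_true (φ : U → V → Y₁ × Y₂ → ℝ) (i : I) (j : J) :
    m.codeMean (fun C D => m.dens (C i) (D j) (φ (C i) (D j))) = m.joint fun _ u v => φ u v := by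
  unfold codeMean
  simp_rw [fun C : I → U => wmean_iid_single (ι := J) m.isMass_pV j
    (fun v => m.dens (C i) v (φ (C i) v))]
  rw [wmean_iid_single (ι := I) m.isMass_pU i
    (fun u => wmean m.pV fun v => m.dens u v (φ u v)), wmean_dens]

/-- The weight `dens` tilts the codewords `i` and `j` only. The codeword `i'` keeps its marginal law
and is independent of the state, the chosen codewords and the outputs. The two lemmas that follow
rest on the same reason. -/
theorem codeMean_wrong_fst (φ : U → V → Y₁ × Y₂ → ℝ) {i i' : I} (hi : i' ≠ i) (j : J) :
    m.codeMean (fun C D => m.dens (C i) (D j) (φ (C i') (D j)))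
      = wmean m.pU fun u' => m.joint fun _ _ v => φ u' v := by
  unfold codeMean
  simp_rw [fun C : I → U => wmean_iid_single (ι := J) m.isMass_pV j
    (fun v => m.dens (C i) v (φ (C i') v))]
  rw [wmean_iid_pair (ι := I) m.isMass_pU hi
    (fun u' u => wmean m.pV fun v => m.dens u v (φ u' v))]
  exact congrArg _ (funext fun u' => m.wmean_dens fun _ v => φ u' v)

theorem codeMean_wrong_snd (φ : U → V → Y₁ × Y₂ → ℝ) (i : I) {j j' : J} (hj : j' ≠ j) :
    m.codeMean (fun C D => m.dens (C i) (D j) (φ (C i) (D j')))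
      = wmean m.pV fun v' => m.joint fun _ u _ => φ u v' := by
  unfold codeMean
  simp_rw [fun C : I → U => wmean_iid_pair (ι := J) m.isMass_pV hj
    (fun v' v => m.dens (C i) v (φ (C i) v'))]
  rw [wmean_iid_single (ι := I) m.isMass_pU i
    (fun u => wmean m.pV fun v' => wmean m.pV fun v => m.dens u v (φ u v')), wmean_comm]
  exact congrArg _ (funext fun v' => m.wmean_dens fun u _ => φ u v')

theorem codeMean_wrong_both (φ : U → V → Y₁ × Y₂ → ℝ) {i i' : I} (hi : i' ≠ i) {j j' : J}
    (hj : j' ≠ j) :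
    m.codeMean (fun C D => m.dens (C i) (D j) (φ (C i') (D j')))
      = wmean m.pU fun u' => wmean m.pV fun v' => m.joint fun _ _ _ => φ u' v' := by
  unfold codeMean
  simp_rw [fun C : I → U => wmean_iid_pair (ι := J) m.isMass_pV hj
    (fun v' v => m.dens (C i) v (φ (C i') v'))]
  rw [wmean_iid_pair (ι := I) m.isMass_pU hi
    (fun u' u => wmean m.pV fun v' => wmean m.pV fun v => m.dens u v (φ u' v'))]
  refine congrArg _ (funext fun u' => ?_)
  rw [wmean_comm]
  exact congrArg _ (funext fun v' => m.wmean_dens fun _ _ => φ u' v')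

end codebook

/-- The probability that receiver tests `A₁`, `A₂` fail or are passed by wrong codewords: the bound
on the error probability of threshold decoding with `Mₖ` messages and `Lₖ` codewords each. -/
noncomputable def decodeBound (A₁ : U → V → Y₁ → Prop) (A₂ : U → V → Y₂ → Prop)
    (M₁ L₁ M₂ L₂ : ℕ) : ℝ :=
  m.joint (fun _ u v y => ind (¬ A₁ u v y.1)) + m.joint (fun _ u v y => ind (¬ A₂ u v y.2))
  + ((M₁ - 1 : ℕ) * L₁ : ℝ) * (wmean m.pU fun u' => m.joint fun _ _ v y => ind (A₁ u' v y.1))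
  + ((M₁ - 1 : ℕ) * L₁ : ℝ) * (M₂ * L₂ : ℝ) *
      (wmean m.pU fun u' => wmean m.pV fun v' => m.joint fun _ _ _ y => ind (A₁ u' v' y.1))
  + ((M₂ - 1 : ℕ) * L₂ : ℝ) * (wmean m.pV fun v' => m.joint fun _ u _ y => ind (A₂ u v' y.2))
  + ((M₂ - 1 : ℕ) * L₂ : ℝ) * (M₁ * L₁ : ℝ) *
      (wmean m.pU fun u' => wmean m.pV fun v' => m.joint fun _ _ _ y => ind (A₂ u' v' y.2))

end CodingModel

theorem card_filter_fst_ne {M K : Type*} [Fintype M] [Fintype K] [DecidableEq M] (w : M) :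
    (Finset.univ.filter (fun i : M × K => i.1 ≠ w)).card
      = (Fintype.card M - 1) * Fintype.card K := by
  have : Finset.univ.filter (fun i : M × K => i.1 ≠ w)
      = (Finset.univ.erase w) ×ˢ (Finset.univ : Finset K) := by
    ext i; simp
  rw [this, Finset.card_product, Finset.card_erase_of_mem (Finset.mem_univ _)]
  simp

namespace CodingModel

variable {S U V X₁ X₂ Y₁ Y₂ : Type*} [Fintype S] [Fintype U] [Fintype V]
    [Fintype X₁] [Fintype X₂] [Fintype Y₁] [Fintype Y₂] (m : CodingModel S U V X₁ X₂ Y₁ Y₂)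

theorem joint_nonneg {F : S → U → V → Y₁ × Y₂ → ℝ} (h : ∀ s u v y, 0 ≤ F s u v y) :
    0 ≤ m.joint F :=
  wmean_nonneg m.isMass_pS.1 fun s => wmean_nonneg (m.isMass_a s).1 fun u =>
    wmean_nonneg (m.isMass_b s).1 fun v => wmean_nonneg (m.isMass_q₁ s u).1 fun x₁ =>
      wmean_nonneg (m.isMass_q₂ s v).1 fun x₂ => wmean_nonneg (m.isMass_W s x₁ x₂).1 (h s u v)

variable {M₁ L₁ M₂ L₂ : ℕ}

/-- Under the ideal law of the codebooks, states and outputs, threshold decoding errs with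
probability at most `decodeBound`. -/
theorem codeMean_error_le [NeZero M₁] [NeZero M₂] (A₁ : U → V → Y₁ → Prop)
    (A₂ : U → V → Y₂ → Prop) (w₁ : Fin M₁) (k : Fin L₁) (w₂ : Fin M₂) (l : Fin L₂) :
    m.codeMean (fun (C : Fin M₁ × Fin L₁ → U) (D : Fin M₂ × Fin L₂ → V) =>
      m.dens (C (w₁, k)) (D (w₂, l)) (fun y =>
        ind ((scanDecode (fun u v => A₁ u v y.1) C D,
          scanDecode (fun v u => A₂ u v y.2) D C) ≠ (w₁, w₂))))
      ≤ m.decodeBound A₁ A₂ M₁ L₁ M₂ L₂ := by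
  set i := (w₁, k) with hi
  set j := (w₂, l) with hj
  set Ti := Finset.univ.filter (fun i' : Fin M₁ × Fin L₁ => i'.1 ≠ w₁) with hTi
  set Tj := Finset.univ.filter (fun j' : Fin M₂ × Fin L₂ => j'.1 ≠ w₂) with hTj
  set Ni := Finset.univ.filter (fun i' : Fin M₁ × Fin L₁ => i' ≠ i) with hNi
  set Nj := Finset.univ.filter (fun j' : Fin M₂ × Fin L₂ => j' ≠ j) with hNj
  have hφ : ∀ (C : Fin M₁ × Fin L₁ → U) (D : Fin M₂ × Fin L₂ → V) (y : Y₁ × Y₂),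
      ind ((scanDecode (fun u v => A₁ u v y.1) C D,
          scanDecode (fun v u => A₂ u v y.2) D C) ≠ (w₁, w₂))
        ≤ (ind (¬ A₁ (C i) (D j) y.1) + ∑ i' ∈ Ti, ind (A₁ (C i') (D j) y.1)
            + ∑ i' ∈ Ti, ∑ j' ∈ Nj, ind (A₁ (C i') (D j') y.1))
          + (ind (¬ A₂ (C i) (D j) y.2) + ∑ j' ∈ Tj, ind (A₂ (C i) (D j') y.2)
            + ∑ j' ∈ Tj, ∑ i' ∈ Ni, ind (A₂ (C i') (D j') y.2)) := by
    intro C D y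
    refine le_trans ?_ (add_le_add
      (ind_scanDecode_ne_le (fun u v => A₁ u v y.1) C D w₁ k j)
      (ind_scanDecode_ne_le (fun v u => A₂ u v y.2) D C w₂ l i))
    refine (ind_mono ?_).trans (ind_or_le _ _)
    intro h
    by_contra hc
    push Not at hc
    exact h (Prod.ext hc.1 hc.2)
  have hTi_ne : ∀ i' ∈ Ti, i' ≠ i := by
    rintro i' h rfl; exact (Finset.mem_filter.1 h).2 rfl
  have hTj_ne : ∀ j' ∈ Tj, j' ≠ j := by
    rintro j' h rfl; exact (Finset.mem_filter.1 h).2 rfl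
  have hcTi : (Ti.card : ℝ) = (M₁ - 1 : ℕ) * L₁ := by
    rw [hTi, card_filter_fst_ne]; simp
  have hcTj : (Tj.card : ℝ) = (M₂ - 1 : ℕ) * L₂ := by
    rw [hTj, card_filter_fst_ne]; simp
  -- For the other user every index except the chosen one counts, including other codewords of its
  -- true message.
  have hcNi : (Ni.card : ℝ) ≤ M₁ * L₁ := by
    have := Finset.card_filter_le (Finset.univ : Finset (Fin M₁ × Fin L₁)) (fun i' => i' ≠ i)
    simp at this
    exact_mod_cast this
  have hcNj : (Nj.card : ℝ) ≤ M₂ * L₂ := by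
    have := Finset.card_filter_le (Finset.univ : Finset (Fin M₂ × Fin L₂)) (fun j' => j' ≠ j)
    simp at this
    exact_mod_cast this
  refine (m.codeMean_mono fun C D => m.dens_mono _ _ (hφ C D)).trans ?_
  simp only [dens_add, dens_sum, codeMean_add, codeMean_sum]
  rw [m.codeMean_true (fun u v y => ind (¬ A₁ u v y.1)),
    m.codeMean_true (fun u v y => ind (¬ A₂ u v y.2)),
    Finset.sum_congr rfl fun i' hi' =>
      m.codeMean_wrong_fst (fun u v y => ind (A₁ u v y.1)) (hTi_ne i' hi') j,
    Finset.sum_congr rfl fun j' hj' =>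
      m.codeMean_wrong_snd (fun u v y => ind (A₂ u v y.2)) i (hTj_ne j' hj'),
    Finset.sum_congr rfl fun i' hi' => Finset.sum_congr rfl fun j' hj' =>
      m.codeMean_wrong_both (fun u v y => ind (A₁ u v y.1)) (hTi_ne i' hi')
        (Finset.mem_filter.1 hj').2,
    Finset.sum_congr rfl fun j' hj' => Finset.sum_congr rfl fun i' hi' =>
      m.codeMean_wrong_both (fun u v y => ind (A₂ u v y.2)) (Finset.mem_filter.1 hi').2
        (hTj_ne j' hj')]
  simp only [Finset.sum_const, nsmul_eq_mul]
  rw [hcTi, hcTj]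
  unfold decodeBound
  have hb₁ : 0 ≤ wmean m.pU fun u' => wmean m.pV fun v' =>
      m.joint fun _ _ _ y => ind (A₁ u' v' y.1) :=
    wmean_nonneg m.isMass_pU.1 fun _ => wmean_nonneg m.isMass_pV.1 fun _ =>
      m.joint_nonneg fun _ _ _ _ => ind_nonneg _
  have hb₂ : 0 ≤ wmean m.pU fun u' => wmean m.pV fun v' =>
      m.joint fun _ _ _ y => ind (A₂ u' v' y.2) :=
    wmean_nonneg m.isMass_pU.1 fun _ => wmean_nonneg m.isMass_pV.1 fun _ =>
      m.joint_nonneg fun _ _ _ _ => ind_nonneg _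
  have h₁ := mul_le_mul_of_nonneg_left (mul_le_mul_of_nonneg_right hcNj hb₁)
    (by positivity : (0 : ℝ) ≤ (M₁ - 1 : ℕ) * L₁)
  have h₂ := mul_le_mul_of_nonneg_left (mul_le_mul_of_nonneg_right hcNi hb₂)
    (by positivity : (0 : ℝ) ≤ (M₂ - 1 : ℕ) * L₂)
  linarith

/-- The bound on the loss from using likelihood encoders with `L₁`, `L₂` codewords per message. -/
noncomputable def coverBound (θ₁ θ₂ : ℝ) (L₁ L₂ : ℕ) : ℝ :=
  (2 * m.joint (fun s u _ _ => ind (θ₁ < m.a s u / m.pU u)) + √(θ₁ / L₁))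
    + (2 * m.joint (fun s _ v _ => ind (θ₂ < m.b s v / m.pV v)) + √(θ₂ / L₂))

/-- The error probability of the random code, for given codebooks and messages. -/
noncomputable def randomError (C : Fin M₁ × Fin L₁ → U) (D : Fin M₂ × Fin L₂ → V)
    (w₁ : Fin M₁) (w₂ : Fin M₂) (φ : Y₁ × Y₂ → ℝ) : ℝ :=
  wmean m.pS fun s =>
    wmean (likelihood fun k => m.a s (C (w₁, k)) / m.pU (C (w₁, k))) fun k =>
      wmean (likelihood fun l => m.b s (D (w₂, l)) / m.pV (D (w₂, l))) fun l =>
        m.out s (C (w₁, k)) (D (w₂, l)) φ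

/-- Averaging `likelihood_pair_le` over states and codebooks leaves the ideal-weight error, bounded
by `B`, and one soft covering term for each user. -/
theorem codeMean_randomError_le [NeZero M₁] [NeZero M₂] [NeZero L₁] [NeZero L₂]
    (w₁ : Fin M₁) (w₂ : Fin M₂)
    (φ : (Fin M₁ × Fin L₁ → U) → (Fin M₂ × Fin L₂ → V) → Y₁ × Y₂ → ℝ)
    (h₀ : ∀ C D y, 0 ≤ φ C D y) (h₁ : ∀ C D y, φ C D y ≤ 1) {B : ℝ}
    (hB : ∀ k l, m.codeMean (fun (C : Fin M₁ × Fin L₁ → U) (D : Fin M₂ × Fin L₂ → V) =>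
      m.dens (C (w₁, k)) (D (w₂, l)) (φ C D)) ≤ B)
    {θ₁ θ₂ : ℝ} (hθ₁ : 0 ≤ θ₁) (hθ₂ : 0 ≤ θ₂) :
    m.codeMean (fun (C : Fin M₁ × Fin L₁ → U) (D : Fin M₂ × Fin L₂ → V) =>
      m.randomError C D w₁ w₂ (φ C D)) ≤ B + m.coverBound θ₁ θ₂ L₁ L₂ := by
  have hL₁ : (0 : ℝ) < L₁ := by exact_mod_cast Nat.pos_of_ne_zero (NeZero.ne L₁)
  have hL₂ : (0 : ℝ) < L₂ := by exact_mod_cast Nat.pos_of_ne_zero (NeZero.ne L₂)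
  have hI := isMass_iid (ι := Fin M₁ × Fin L₁) m.isMass_pU
  have hJ := isMass_iid (ι := Fin M₂ × Fin L₂) m.isMass_pV
  set d₁ : S → (Fin M₁ × Fin L₁ → U) → ℝ :=
    fun s C => (∑ k, m.a s (C (w₁, k)) / m.pU (C (w₁, k))) / L₁ with hd₁
  set d₂ : S → (Fin M₂ × Fin L₂ → V) → ℝ :=
    fun s D => (∑ l, m.b s (D (w₂, l)) / m.pV (D (w₂, l))) / L₂ with hd₂
  have hinj₁ : Function.Injective (fun k : Fin L₁ => (w₁, k)) := fun k k' h => (Prod.ext_iff.1 h).2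
  have hinj₂ : Function.Injective (fun l : Fin L₂ => (w₂, l)) := fun k k' h => (Prod.ext_iff.1 h).2
  have step : ∀ (C : Fin M₁ × Fin L₁ → U) (D : Fin M₂ × Fin L₂ → V),
      m.randomError C D w₁ w₂ (φ C D)
        ≤ (1 / (L₁ * L₂ : ℝ)) * (∑ k, ∑ l, m.dens (C (w₁, k)) (D (w₂, l)) (φ C D))
          + (wmean m.pS (fun s => |1 - d₁ s C|)
            + wmean m.pS (fun s => d₁ s C * |1 - d₂ s D|)) := by
    intro C D
    have e : (1 / (L₁ * L₂ : ℝ)) * (∑ k, ∑ l, m.dens (C (w₁, k)) (D (w₂, l)) (φ C D))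
        = wmean m.pS fun s => ∑ k, ∑ l, m.a s (C (w₁, k)) / m.pU (C (w₁, k)) / L₁
            * (m.b s (D (w₂, l)) / m.pV (D (w₂, l)) / L₂)
            * m.out s (C (w₁, k)) (D (w₂, l)) (φ C D) := by
      simp only [dens, ← wmean_sum, ← wmean_const_mul]
      refine congrArg (wmean m.pS) (funext fun s => ?_)
      simp only [Finset.mul_sum]
      refine Finset.sum_congr rfl fun k _ => Finset.sum_congr rfl fun l _ => ?_
      ring
    rw [e, ← wmean_add, ← wmean_add]
    refine wmean_mono m.isMass_pS.1 fun s => ?_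
    have := likelihood_pair_le (r := fun k : Fin L₁ => m.a s (C (w₁, k)) / m.pU (C (w₁, k)))
      (t := fun l : Fin L₂ => m.b s (D (w₂, l)) / m.pV (D (w₂, l)))
      (fun k => m.density_nonneg _ _) (fun l => m.density_nonneg' _ _)
      (e := fun k l => m.out s (C (w₁, k)) (D (w₂, l)) (φ C D))
      (fun k l => (m.out_const s _ _ 0).symm.trans_le (m.out_mono s _ _ (h₀ C D)))
      (fun k l => (m.out_mono s _ _ (h₁ C D)).trans_eq (m.out_const s _ _ 1))
    simp only [Fintype.card_fin] at this
    rw [← add_assoc]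
    exact this
  have hdens : (1 / (L₁ * L₂ : ℝ)) * (∑ k, ∑ l, m.codeMean
      (fun (C : Fin M₁ × Fin L₁ → U) (D : Fin M₂ × Fin L₂ → V) =>
        m.dens (C (w₁, k)) (D (w₂, l)) (φ C D))) ≤ B := by
    calc _ ≤ (1 / (L₁ * L₂ : ℝ)) * (∑ _k : Fin L₁, ∑ _l : Fin L₂, B) := by
          gcongr with k _ l _; exact hB k l
      _ = B := by simp; field_simp
  have hcov₁ : m.codeMean (fun (C : Fin M₁ × Fin L₁ → U) (_ : Fin M₂ × Fin L₂ → V) =>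
      wmean m.pS (fun s => |1 - d₁ s C|))
      ≤ 2 * m.joint (fun s u _ _ => ind (θ₁ < m.a s u / m.pU u)) + √(θ₁ / L₁) := by
    unfold codeMean
    simp only [wmean_const hJ]
    rw [wmean_comm, joint_fst, ← wmean_const_mul, ← wmean_const m.isMass_pS (√(θ₁ / L₁)),
      ← wmean_add]
    refine wmean_le_of_ne_zero m.isMass_pS.1 fun s hs => ?_
    have := soft_covering (e := fun k : Fin L₁ => (w₁, k)) m.isMass_pU (m.isMass_a s)
      (fun u hu => kernel_eq_zero_of_marginal m.isMass_pS m.isMass_a hs hu) hinj₁ hθ₁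
    simpa only [Fintype.card_fin] using this
  have hcov₂ : m.codeMean (fun (C : Fin M₁ × Fin L₁ → U) (D : Fin M₂ × Fin L₂ → V) =>
      wmean m.pS (fun s => d₁ s C * |1 - d₂ s D|))
      ≤ 2 * m.joint (fun s _ v _ => ind (θ₂ < m.b s v / m.pV v)) + √(θ₂ / L₂) := by
    unfold codeMean
    simp only [wmean_comm _ m.pS]
    rw [joint_snd, ← wmean_const_mul, ← wmean_const m.isMass_pS (√(θ₂ / L₂)), ← wmean_add]
    refine wmean_le_of_ne_zero m.isMass_pS.1 fun s hs => ?_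
    have h₂ := soft_covering (e := fun l : Fin L₂ => (w₂, l)) m.isMass_pV (m.isMass_b s)
      (fun v hv => kernel_eq_zero_of_marginal m.isMass_pS m.isMass_b hs hv) hinj₂ hθ₂
    simp only [Fintype.card_fin] at h₂
    simp only [wmean_const_mul, wmean_mul_const]
    -- The codebooks are independent, so the total weight of user 1 factors out of the second
    -- covering term, and its mean is 1.
    have e₁ : wmean (iidMass m.pU) (fun C : Fin M₁ × Fin L₁ → U => d₁ s C) = 1 := by
      simp only [hd₁, div_eq_mul_inv _ (L₁ : ℝ), wmean_mul_const, wmean_sum]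
      have : ∀ k : Fin L₁, wmean (iidMass m.pU) (fun C : Fin M₁ × Fin L₁ → U =>
          m.a s (C (w₁, k)) / m.pU (C (w₁, k))) = 1 := by
        intro k
        rw [wmean_iid_single m.isMass_pU (w₁, k) (fun u => m.a s u / m.pU u)]
        have := wmean_marginal_density m.isMass_pS m.isMass_a hs (fun _ => 1)
        rw [wmean_const (m.isMass_a s)] at this
        simp only [mul_one] at this
        exact this
      simp only [this, Finset.sum_const, Finset.card_univ, Fintype.card_fin, nsmul_eq_mul, mul_one]
      field_simp
    rw [e₁, one_mul]
    exact h₂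
  refine (m.codeMean_mono step).trans ?_
  rw [codeMean_add, codeMean_add, codeMean_const_mul]
  simp only [codeMean_sum]
  unfold coverBound
  linarith

/-- One-shot achievability: there is a deterministic code whose average error probability is at
most the covering loss plus the bound for threshold decoding. -/
theorem exists_code [NeZero M₁] [NeZero M₂] [NeZero L₁] [NeZero L₂] (A₁ : U → V → Y₁ → Prop)
    (A₂ : U → V → Y₂ → Prop) {θ₁ θ₂ : ℝ} (hθ₁ : 0 ≤ θ₁) (hθ₂ : 0 ≤ θ₂) :
    ∃ (f₁ : Fin M₁ → S → X₁) (f₂ : Fin M₂ → S → X₂) (g₁ : Y₁ → Fin M₁) (g₂ : Y₂ → Fin M₂),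
      ∑ w₁, ∑ w₂, wmean m.pS (fun s => wmean (m.W s (f₁ w₁ s) (f₂ w₂ s)) fun y =>
          ind ((g₁ y.1, g₂ y.2) ≠ (w₁, w₂)))
        ≤ (M₁ * M₂ : ℝ) *
          (m.decodeBound A₁ A₂ M₁ L₁ M₂ L₂ + m.coverBound θ₁ θ₂ L₁ L₂) := by
  set T := m.decodeBound A₁ A₂ M₁ L₁ M₂ L₂ + m.coverBound θ₁ θ₂ L₁ L₂ with hT
  let G₁ : (Fin M₁ × Fin L₁ → U) → (Fin M₂ × Fin L₂ → V) → Y₁ → Fin M₁ :=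
    fun C D y => scanDecode (fun u v => A₁ u v y) C D
  let G₂ : (Fin M₁ × Fin L₁ → U) → (Fin M₂ × Fin L₂ → V) → Y₂ → Fin M₂ :=
    fun C D y => scanDecode (fun v u => A₂ u v y) D C
  have havg : m.codeMean (fun (C : Fin M₁ × Fin L₁ → U) (D : Fin M₂ × Fin L₂ → V) =>
      ∑ w₁, ∑ w₂, m.randomError C D w₁ w₂
        (fun y => ind ((G₁ C D y.1, G₂ C D y.2) ≠ (w₁, w₂)))) ≤ M₁ * M₂ * T := by
    simp only [codeMean_sum]
    calc _ ≤ ∑ _w₁ : Fin M₁, ∑ _w₂ : Fin M₂, T := by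
          refine Finset.sum_le_sum fun w₁ _ => Finset.sum_le_sum fun w₂ _ => ?_
          exact m.codeMean_randomError_le w₁ w₂
            (fun C D y => ind ((G₁ C D y.1, G₂ C D y.2) ≠ (w₁, w₂)))
            (fun _ _ _ => ind_nonneg _) (fun _ _ _ => ind_le_one _)
            (fun k l => m.codeMean_error_le A₁ A₂ w₁ k w₂ l) hθ₁ hθ₂
      _ = M₁ * M₂ * T := by simp [mul_assoc]
  -- Some codebooks do no worse than the average. The randomness still left at each encoder is the
  -- codeword index together with the channel input.
  obtain ⟨C, hC⟩ := exists_le_of_wmean_le (isMass_iid m.isMass_pU) havg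
  obtain ⟨D, hD⟩ := exists_le_of_wmean_le (isMass_iid m.isMass_pV) hC
  have hdet := exists_deterministic_pair
    (K₁ := fun (w₁ : Fin M₁) s (x : Fin L₁ × X₁) =>
      likelihood (fun k => m.a s (C (w₁, k)) / m.pU (C (w₁, k))) x.1 * m.q₁ s (C (w₁, x.1)) x.2)
    (K₂ := fun (w₂ : Fin M₂) s (x : Fin L₂ × X₂) =>
      likelihood (fun l => m.b s (D (w₂, l)) / m.pV (D (w₂, l))) x.1 * m.q₂ s (D (w₂, x.1)) x.2)
    (fun w₁ s => (isMass_likelihood fun k => m.density_nonneg s (C (w₁, k))).mul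
      fun k => m.isMass_q₁ s (C (w₁, k)))
    (fun w₂ s => (isMass_likelihood fun l => m.density_nonneg' s (D (w₂, l))).mul
      fun l => m.isMass_q₂ s (D (w₂, l)))
    m.pS (fun s w₁ w₂ x x' => wmean (m.W s x.2 x'.2) fun y =>
      ind ((G₁ C D y.1, G₂ C D y.2) ≠ (w₁, w₂)))
  obtain ⟨f₁, f₂, hf⟩ := hdet
  refine ⟨fun w s => (f₁ w s).2, fun w s => (f₂ w s).2, G₁ C D, G₂ C D, hf.trans ?_⟩
  refine le_trans (le_of_eq ?_) hD
  refine Finset.sum_congr rfl fun w₁ _ => Finset.sum_congr rfl fun w₂ _ => ?_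
  unfold randomError out
  refine congrArg (wmean m.pS) (funext fun s => ?_)
  refine (wmean_mass_mul (likelihood fun k => m.a s (C (w₁, k)) / m.pU (C (w₁, k)))
    (fun k => m.q₁ s (C (w₁, k))) (fun _ x => wmean
      (fun x : Fin L₂ × X₂ => likelihood (fun l => m.b s (D (w₂, l)) / m.pV (D (w₂, l))) x.1 *
        m.q₂ s (D (w₂, x.1)) x.2)
      fun x' => wmean (m.W s x x'.2) fun y =>
        ind ((G₁ C D y.1, G₂ C D y.2) ≠ (w₁, w₂)))).trans ?_
  refine congrArg (wmean _) (funext fun k => ?_)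
  rw [wmean_comm _ (m.q₁ s (C (w₁, k)))]
  refine congrArg (wmean _) (funext fun x => ?_)
  exact wmean_mass_mul (likelihood fun l => m.b s (D (w₂, l)) / m.pV (D (w₂, l)))
    (fun l => m.q₂ s (D (w₂, l))) (fun _ x' => wmean (m.W s x x') fun y =>
        ind ((G₁ C D y.1, G₂ C D y.2) ≠ (w₁, w₂)))

end CodingModel

/-! ### I.i.d. laws and their images -/

section iid_image

theorem probEq_eq_wmean {Ω α : Type*} [Fintype Ω] (p : Ω → ℝ) (X : Ω → α) (x : α) :
    probEq p X x = wmean p (fun ω => ind (X ω = x)) := by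
  unfold probEq wmean
  refine Finset.sum_congr rfl fun ω _ => ?_
  by_cases h : X ω = x
  · simp only [ind_of_true h, if_pos h, mul_one]
  · simp only [ind_of_false h, if_neg h, mul_zero]

theorem probEq_nonneg {Ω α : Type*} [Fintype Ω] {p : Ω → ℝ} (hp : ∀ ω, 0 ≤ p ω) (X : Ω → α)
    (x : α) : 0 ≤ probEq p X x := by
  rw [probEq_eq_wmean]; exact wmean_nonneg hp fun _ => ind_nonneg _

theorem probEq_pos {Ω α : Type*} [Fintype Ω] {p : Ω → ℝ} (hp : ∀ ω, 0 ≤ p ω) (X : Ω → α)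
    {ω : Ω} (hω : p ω ≠ 0) : 0 < probEq p X (X ω) := by
  have hpos : 0 < p ω := lt_of_le_of_ne (hp ω) (Ne.symm hω)
  rw [probEq_eq_wmean]
  refine lt_of_lt_of_le hpos ?_
  have := Finset.single_le_sum (f := fun ω' => p ω' * ind (X ω' = X ω))
    (fun ω' _ => mul_nonneg (hp ω') (ind_nonneg _)) (Finset.mem_univ ω)
  simp only [ind_of_true, mul_one] at this
  exact this

open Classical in
theorem wmean_probEq {Ω α : Type*} [Fintype Ω] [Fintype α] (p : Ω → ℝ) (X : Ω → α) (F : α → ℝ) :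
    wmean (probEq p X) F = wmean p (fun ω => F (X ω)) := by
  unfold wmean probEq
  simp only [Finset.sum_mul]
  rw [Finset.sum_comm]
  exact Finset.sum_congr rfl fun ω _ => by simp

theorem isMass_probEq {Ω α : Type*} [Fintype Ω] [Fintype α] {p : Ω → ℝ} (hp : IsMass p)
    (X : Ω → α) : IsMass (probEq p X) := by
  refine ⟨probEq_nonneg hp.1 X, ?_⟩
  have := wmean_probEq p X (fun _ => 1)
  rw [wmean_const hp] at this
  simpa [wmean] using this

variable {ι : Type*} [Fintype ι] [DecidableEq ι]

theorem isMass_pi {α : Type*} [Fintype α] {p : ι → α → ℝ} (hp : ∀ i, IsMass (p i)) :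
    IsMass (fun x : ι → α => ∏ i, p i (x i)) := by
  refine ⟨fun x => Finset.prod_nonneg fun i _ => (hp i).1 _, ?_⟩
  rw [← Fintype.prod_sum]
  simp [(hp _).2]

open Classical in
/-- The image of an i.i.d. family is i.i.d. -/
theorem wmean_iid_map {Ω α : Type*} [Fintype Ω] [Fintype α] (p : Ω → ℝ) (X : Ω → α)
    (F : (ι → α) → ℝ) :
    wmean (iidMass (probEq p X)) F = wmean (iidMass p) (fun ω : ι → Ω => F (fun i => X (ω i))) := by
  have h : (iidMass (probEq p X) : (ι → α) → ℝ)
      = probEq (iidMass p) (fun (ω : ι → Ω) i => X (ω i)) := by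
    funext x
    unfold iidMass probEq
    rw [Fintype.prod_sum]
    refine Finset.sum_congr rfl fun ω _ => ?_
    split_ifs with hc
    · exact Finset.prod_congr rfl fun i _ => by rw [if_pos (congrFun hc i)]
    · obtain ⟨i, hi⟩ := not_forall.1 (fun h => hc (funext h))
      exact Finset.prod_eq_zero (Finset.mem_univ i) (if_neg hi)
  rw [h, wmean_probEq]

theorem wmean_iid_prod {α β : Type*} [Fintype α] [Fintype β] (p : α → ℝ) (q : β → ℝ)
    (F : (ι → α) → (ι → β) → ℝ) :
    wmean (iidMass p) (fun x => wmean (iidMass q) (F x))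
      = wmean (iidMass (fun z : α × β => p z.1 * q z.2))
          (fun z => F (fun i => (z i).1) (fun i => (z i).2)) := by
  have h : wmean (iidMass (fun z : α × β => p z.1 * q z.2))
      (fun z : ι → α × β => F (fun i => (z i).1) (fun i => (z i).2))
      = ∑ z : (ι → α) × (ι → β), (∏ i, p (z.1 i) * q (z.2 i)) * F z.1 z.2 :=
    Fintype.sum_equiv (Equiv.arrowProdEquivProdArrow ι (fun _ => α) (fun _ => β)) _ _ fun z => rfl
  rw [h, Fintype.sum_prod_type]
  simp only [wmean, iidMass, Finset.mul_sum, Finset.prod_mul_distrib, mul_assoc]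

end iid_image

/-! ### Likelihood ratio tests on i.i.d. sequences -/

theorem logb_prod_of_iidMass_ne_zero {ι Ω : Type*} [Fintype ι] {p g : Ω → ℝ}
    (hg : ∀ ω, p ω ≠ 0 → 0 < g ω) {ω : ι → Ω}
    (hω : iidMass p ω ≠ 0) :
    0 < ∏ i, g (ω i) ∧ Real.logb 2 (∏ i, g (ω i)) = ∑ i, Real.logb 2 (g (ω i)) := by
  have hi : ∀ i, 0 < g (ω i) := fun i =>
    hg _ (Finset.prod_ne_zero_iff.1 hω i (Finset.mem_univ i))
  refine ⟨Finset.prod_pos fun i _ => hi i, ?_⟩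
  rw [Real.logb, Real.log_prod fun i _ => (hi i).ne', Finset.sum_div]
  rfl

section tests
variable {ι : Type*} [Fintype ι] [DecidableEq ι]

/-- On the event the mass under `Q` is less than `c⁻¹` times the mass under `P`, and the latter sums
to at most 1. -/
theorem wmean_iid_test_le {α : Type*} [Fintype α] {P Q : α → ℝ} (hP : IsMass P)
    {c : ℝ} (hc : 0 < c) :
    wmean (iidMass Q) (fun x : ι → α => ind (c * iidMass Q x < iidMass P x)) ≤ c⁻¹ := by
  rw [← mul_one c⁻¹, ← (isMass_iid (ι := ι) hP).2, Finset.mul_sum]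
  refine Finset.sum_le_sum fun x _ => ?_
  have hP0 := (isMass_iid (ι := ι) hP).1 x
  beta_reduce
  by_cases h : c * iidMass Q x < iidMass P x
  · rw [ind_of_true h, mul_one, inv_mul_eq_div, le_div_iff₀ hc]; linarith
  · rw [ind_of_false h, mul_zero]; positivity

/-- A wrong codeword drawn independently of `Z` rarely passes the likelihood ratio test. -/
theorem test_wrong_one {Ω α ζ : Type*} [Fintype Ω] [Fintype α] [Fintype ζ] (p : Ω → ℝ)
    (Z : Ω → ζ) {P : α × ζ → ℝ} (hP : IsMass P) {Q : α → ℝ}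
    {c : ℝ} (hc : 0 < c) :
    wmean (iidMass Q) (fun x : ι → α => wmean (iidMass p) fun ω =>
      ind (c * ∏ i, (Q (x i) * probEq p Z (Z (ω i))) < ∏ i, P (x i, Z (ω i)))) ≤ c⁻¹ := by
  have h : ∀ x : ι → α, wmean (iidMass p) (fun ω =>
      ind (c * ∏ i, (Q (x i) * probEq p Z (Z (ω i))) < ∏ i, P (x i, Z (ω i))))
      = wmean (iidMass (probEq p Z)) (fun z =>
        ind (c * ∏ i, (Q (x i) * probEq p Z (z i)) < ∏ i, P (x i, z i))) :=
    fun x => (wmean_iid_map p Z fun z =>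
        ind (c * ∏ i, (Q (x i) * probEq p Z (z i)) < ∏ i, P (x i, z i))).symm
  simp only [h]
  rw [wmean_iid_prod]
  exact wmean_iid_test_le hP
    (Q := fun z : α × ζ => Q z.1 * probEq p Z z.2) hc

/-- Two wrong codewords drawn independently of `Z` rarely pass the likelihood ratio test. -/
theorem test_wrong_two {Ω α β ζ : Type*} [Fintype Ω] [Fintype α] [Fintype β] [Fintype ζ]
    (p : Ω → ℝ) (Z : Ω → ζ) {P : α × β × ζ → ℝ} (hP : IsMass P) {Q : α → ℝ}
    {Q' : β → ℝ} {c : ℝ} (hc : 0 < c) :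
    wmean (iidMass Q) (fun x : ι → α => wmean (iidMass Q') fun x' => wmean (iidMass p) fun ω =>
      ind (c * ∏ i, (Q (x i) * (Q' (x' i) * probEq p Z (Z (ω i))))
        < ∏ i, P (x i, x' i, Z (ω i)))) ≤ c⁻¹ := by
  have h : ∀ (x : ι → α) (x' : ι → β), wmean (iidMass p) (fun ω =>
      ind (c * ∏ i, (Q (x i) * (Q' (x' i) * probEq p Z (Z (ω i))))
        < ∏ i, P (x i, x' i, Z (ω i))))
      = wmean (iidMass (probEq p Z)) (fun z =>
        ind (c * ∏ i, (Q (x i) * (Q' (x' i) * probEq p Z (z i))) < ∏ i, P (x i, x' i, z i))) :=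
    fun x x' => (wmean_iid_map p Z fun z => ind (c * ∏ i, (Q (x i) * (Q' (x' i) * probEq p Z (z i)))
      < ∏ i, P (x i, x' i, z i))).symm
  simp only [h]
  simp only [wmean_iid_prod]
  exact wmean_iid_test_le hP
    (Q := fun z : α × β × ζ => Q z.1 * (Q' z.2.1 * probEq p Z z.2.2)) hc

variable {Ω : Type*} [Fintype Ω] {p : Ω → ℝ}

theorem tendsto_deviation (hp : IsMass p) (f : Ω → ℝ) {δ : ℝ} (hδ : 0 < δ) :
    Tendsto (fun n : ℕ => wmean (iidMass p) (fun ω : Fin n → Ω =>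
      ind (δ * n ≤ |∑ i, f (ω i) - n * wmean p f|))) atTop (𝓝 0) := by
  set σ := wmean p (fun a => (f a - wmean p f) ^ 2)
  have hlim : Tendsto (fun n : ℕ => σ / δ ^ 2 / (n : ℝ)) atTop (𝓝 0) :=
    tendsto_const_div_atTop_nhds_zero_nat _
  refine tendsto_of_tendsto_of_tendsto_of_le_of_le' tendsto_const_nhds hlim
    (Eventually.of_forall fun n => wmean_nonneg (isMass_iid hp).1 fun _ => ind_nonneg _) ?_
  filter_upwards [eventually_ge_atTop 1] with n hn
  have : Nonempty (Fin n) := ⟨⟨0, hn⟩⟩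
  have := wmean_iid_deviation (ι := Fin n) hp f hδ
  rw [Fintype.card_fin] at this
  rw [div_div]
  exact this

/-- Taking logarithms turns the product into a sum of i.i.d. terms with mean `μ`, so the event is a
deviation by at least `n (μ - γ)`. Positivity of `g` is needed only on the support of `p`. -/
theorem tendsto_prod_le (hp : IsMass p) {g : Ω → ℝ} (hg : ∀ ω, p ω ≠ 0 → 0 < g ω) {μ γ : ℝ}
    (hμ : wmean p (fun ω => Real.logb 2 (g ω)) = μ) (hγ : γ < μ) :
    Tendsto (fun n : ℕ => wmean (iidMass p) (fun ω : Fin n → Ω =>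
      ind (∏ i, g (ω i) ≤ (2 : ℝ) ^ ((n : ℝ) * γ)))) atTop (𝓝 0) := by
  refine tendsto_of_tendsto_of_tendsto_of_le_of_le tendsto_const_nhds
    (tendsto_deviation hp (fun ω => Real.logb 2 (g ω)) (sub_pos.2 hγ))
    (fun n => wmean_nonneg (isMass_iid hp).1 fun _ => ind_nonneg _) fun n => ?_
  refine wmean_le_of_ne_zero (isMass_iid hp).1 fun ω hω => ind_mono fun h => ?_
  obtain ⟨hpos, hlog⟩ := logb_prod_of_iidMass_ne_zero hg hω
  have h2 := (Real.logb_le_iff_le_rpow (by norm_num : (1 : ℝ) < 2) hpos).2 h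
  rw [hlog] at h2
  rw [hμ, abs_sub_comm]
  exact le_trans (by linarith) (le_abs_self _)

theorem tendsto_lt_prod (hp : IsMass p) {g : Ω → ℝ} (hg : ∀ ω, p ω ≠ 0 → 0 < g ω) {μ γ : ℝ}
    (hμ : wmean p (fun ω => Real.logb 2 (g ω)) = μ) (hγ : μ < γ) :
    Tendsto (fun n : ℕ => wmean (iidMass p) (fun ω : Fin n → Ω =>
      ind ((2 : ℝ) ^ ((n : ℝ) * γ) < ∏ i, g (ω i)))) atTop (𝓝 0) := by
  refine tendsto_of_tendsto_of_tendsto_of_le_of_le tendsto_const_nhds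
    (tendsto_deviation hp (fun ω => Real.logb 2 (g ω)) (sub_pos.2 hγ))
    (fun n => wmean_nonneg (isMass_iid hp).1 fun _ => ind_nonneg _) fun n => ?_
  refine wmean_le_of_ne_zero (isMass_iid hp).1 fun ω hω => ind_mono fun h => ?_
  obtain ⟨hpos, hlog⟩ := logb_prod_of_iidMass_ne_zero hg hω
  have h2 := (Real.lt_logb_iff_rpow_lt (by norm_num : (1 : ℝ) < 2) hpos).2 h
  rw [hlog] at h2
  rw [hμ]
  exact le_trans (by linarith) (le_abs_self _)

/-- The correct codewords pass the likelihood ratio test with high probability. -/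
theorem tendsto_not_test (hp : IsMass p) {P Q : Ω → ℝ} (hP : ∀ ω, p ω ≠ 0 → 0 < P ω)
    (hQ : ∀ ω, p ω ≠ 0 → 0 < Q ω) {μ γ : ℝ}
    (hμ : wmean p (fun ω => Real.logb 2 (P ω / Q ω)) = μ) (hγ : γ < μ) :
    Tendsto (fun n : ℕ => wmean (iidMass p) (fun ω : Fin n → Ω =>
      ind (¬ ((2 : ℝ) ^ ((n : ℝ) * γ) * ∏ i, Q (ω i) < ∏ i, P (ω i))))) atTop (𝓝 0) := by
  refine tendsto_of_tendsto_of_tendsto_of_le_of_le tendsto_const_nhds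
    (tendsto_prod_le hp (fun ω h => div_pos (hP ω h) (hQ ω h)) hμ hγ)
    (fun n => wmean_nonneg (isMass_iid hp).1 fun _ => ind_nonneg _) fun n => ?_
  refine wmean_le_of_ne_zero (isMass_iid hp).1 fun ω hω => ind_mono fun h => ?_
  have hpos := (logb_prod_of_iidMass_ne_zero hQ hω).1
  rw [Finset.prod_div_distrib, div_le_iff₀ hpos]
  exact not_lt.1 h

end tests

/-! ### Block coding -/

namespace CodingModel

variable {S U V X₁ X₂ Y₁ Y₂ : Type*} [Fintype S] [Fintype U] [Fintype V]
    [Fintype X₁] [Fintype X₂] [Fintype Y₁] [Fintype Y₂] (m : CodingModel S U V X₁ X₂ Y₁ Y₂)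

/-- The joint mass function. -/
noncomputable def law (t : S × U × V × X₁ × X₂ × Y₁ × Y₂) : ℝ :=
  m.pS t.1 * m.a t.1 t.2.1 * m.b t.1 t.2.2.1 * m.q₁ t.1 t.2.1 t.2.2.2.1 *
    m.q₂ t.1 t.2.2.1 t.2.2.2.2.1 * m.W t.1 t.2.2.2.1 t.2.2.2.2.1 t.2.2.2.2.2

theorem joint_eq_wmean_law (F : S → U → V → Y₁ × Y₂ → ℝ) :
    m.joint F = wmean m.law (fun t => F t.1 t.2.1 t.2.2.1 t.2.2.2.2.2) := by
  simp only [joint, out, wmean, law, Fintype.sum_prod_type (α₁ := S),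
    Fintype.sum_prod_type (α₁ := U), Fintype.sum_prod_type (α₁ := V),
    Fintype.sum_prod_type (α₁ := X₁), Fintype.sum_prod_type (α₁ := X₂), Finset.mul_sum, mul_assoc]

theorem isMass_law : IsMass m.law := by
  refine ⟨fun t => ?_, ?_⟩
  · have h₁ := m.isMass_pS.1 t.1
    have h₂ := (m.isMass_a t.1).1 t.2.1
    have h₃ := (m.isMass_b t.1).1 t.2.2.1
    have h₄ := (m.isMass_q₁ t.1 t.2.1).1 t.2.2.2.1
    have h₅ := (m.isMass_q₂ t.1 t.2.2.1).1 t.2.2.2.2.1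
    have h₆ := (m.isMass_W t.1 t.2.2.2.1 t.2.2.2.2.1).1 t.2.2.2.2.2
    unfold law; positivity
  · have := m.joint_eq_wmean_law (fun _ _ _ _ => 1)
    rw [joint_fst m (fun _ _ => 1)] at this
    simp only [wmean_const (m.isMass_a _), wmean_const m.isMass_pS] at this
    simpa [wmean] using this.symm

theorem pU_eq : m.pU = probEq m.law (fun t => t.2.1) := by
  funext u
  have := m.joint_eq_wmean_law (fun _ u' _ _ => ind (u' = u))
  rw [joint_fst m (fun _ u' => ind (u' = u)), ← probEq_eq_wmean m.law (fun t => t.2.1)] at this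
  rw [← this]
  unfold pU kernelMarginal
  refine congrArg _ (funext fun s => ?_)
  classical
  simp [wmean, ind]

theorem pV_eq : m.pV = probEq m.law (fun t => t.2.2.1) := by
  funext v
  have := m.joint_eq_wmean_law (fun _ _ v' _ => ind (v' = v))
  rw [joint_snd m (fun _ v' => ind (v' = v)), ← probEq_eq_wmean m.law (fun t => t.2.2.1)] at this
  rw [← this]
  unfold pV kernelMarginal
  refine congrArg _ (funext fun s => ?_)
  classical
  simp [wmean, ind]

/-- The model for `n` independent uses. -/
noncomputable def block (n : ℕ) : CodingModel (Fin n → S) (Fin n → U) (Fin n → V) (Fin n → X₁)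
    (Fin n → X₂) (Fin n → Y₁) (Fin n → Y₂) where
  pS := iidMass m.pS
  a s u := ∏ i, m.a (s i) (u i)
  b s v := ∏ i, m.b (s i) (v i)
  q₁ s u x := ∏ i, m.q₁ (s i) (u i) (x i)
  q₂ s v x := ∏ i, m.q₂ (s i) (v i) (x i)
  W s x₁ x₂ y := ∏ i, m.W (s i) (x₁ i) (x₂ i) (y.1 i, y.2 i)
  isMass_pS := isMass_iid m.isMass_pS
  isMass_a s := isMass_pi fun i => m.isMass_a (s i)
  isMass_b s := isMass_pi fun i => m.isMass_b (s i)
  isMass_q₁ s u := isMass_pi fun i => m.isMass_q₁ (s i) (u i)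
  isMass_q₂ s v := isMass_pi fun i => m.isMass_q₂ (s i) (v i)
  isMass_W s x₁ x₂ := by
    have h := isMass_pi fun i => m.isMass_W (s i) (x₁ i) (x₂ i)
    refine ⟨fun y => h.1 (fun i => (y.1 i, y.2 i)), ?_⟩
    rw [← h.2]
    exact Fintype.sum_equiv (Equiv.arrowProdEquivProdArrow (Fin n) (fun _ => Y₁) (fun _ => Y₂)).symm
      _ _ fun y => rfl

theorem block_pU (n : ℕ) : (m.block n).pU = iidMass m.pU := by
  funext u
  unfold pU kernelMarginal wmean iidMass block
  rw [Fintype.prod_sum]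
  exact Finset.sum_congr rfl fun s _ => (Finset.prod_mul_distrib (s := Finset.univ)
    (f := fun i => m.pS (s i)) (g := fun i => m.a (s i) (u i))).symm

theorem block_pV (n : ℕ) : (m.block n).pV = iidMass m.pV := by
  funext u
  unfold pV kernelMarginal wmean iidMass block
  rw [Fintype.prod_sum]
  exact Finset.sum_congr rfl fun s _ => (Finset.prod_mul_distrib (s := Finset.univ)
    (f := fun i => m.pS (s i)) (g := fun i => m.b (s i) (u i))).symm

/-- Sequences of tuples as tuples of sequences. -/
def seqEquiv (S U V X₁ X₂ Y₁ Y₂ : Type*) (n : ℕ) :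
    (Fin n → S × U × V × X₁ × X₂ × Y₁ × Y₂) ≃ (Fin n → S) × (Fin n → U) × (Fin n → V) ×
      (Fin n → X₁) × (Fin n → X₂) × (Fin n → Y₁) × (Fin n → Y₂) where
  toFun t := (fun i => (t i).1, fun i => (t i).2.1, fun i => (t i).2.2.1, fun i => (t i).2.2.2.1,
    fun i => (t i).2.2.2.2.1, fun i => (t i).2.2.2.2.2.1, fun i => (t i).2.2.2.2.2.2)
  invFun t i := (t.1 i, t.2.1 i, t.2.2.1 i, t.2.2.2.1 i, t.2.2.2.2.1 i, t.2.2.2.2.2.1 i,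
    t.2.2.2.2.2.2 i)
  left_inv _ := rfl
  right_inv _ := rfl

theorem block_joint (n : ℕ)
    (F : (Fin n → S) → (Fin n → U) → (Fin n → V) → (Fin n → Y₁) × (Fin n → Y₂) → ℝ) :
    (m.block n).joint F = wmean (iidMass m.law) (fun t => F (fun i => (t i).1)
      (fun i => (t i).2.1) (fun i => (t i).2.2.1)
      (fun i => (t i).2.2.2.2.2.1, fun i => (t i).2.2.2.2.2.2)) := by
  rw [joint_eq_wmean_law]
  unfold wmean
  refine Fintype.sum_equiv (seqEquiv S U V X₁ X₂ Y₁ Y₂ n).symm _ _ fun t => ?_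
  congr 1
  simp only [law, block, iidMass, Finset.prod_mul_distrib]
  rfl

end CodingModel

/-! ### Numbers of messages -/

section numMessages
open StateIC

theorem one_le_numMessages (R : ℝ) (n : ℕ) : 1 ≤ numMessages R n :=
  Nat.one_le_iff_ne_zero.2 (Nat.ceil_pos.2 (by positivity)).ne'

theorem le_numMessages (R : ℝ) (n : ℕ) : (2 : ℝ) ^ ((n : ℝ) * R) ≤ numMessages R n :=
  Nat.le_ceil _

/-- Rounding up adds at most 1, and 1 ≤ 2^(nR) because the rate is nonnegative. -/
theorem numMessages_le {R : ℝ} (hR : 0 ≤ R) (n : ℕ) :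
    (numMessages R n : ℝ) ≤ 2 * (2 : ℝ) ^ ((n : ℝ) * R) := by
  have h := (Nat.ceil_lt_add_one (by positivity : (0 : ℝ) ≤ (2 : ℝ) ^ ((n : ℝ) * R))).le
  have h1 : (1 : ℝ) ≤ (2 : ℝ) ^ ((n : ℝ) * R) :=
    Real.one_le_rpow (by norm_num) (by positivity)
  unfold numMessages
  linarith

theorem numMessages_sub_one_le (R : ℝ) (n : ℕ) :
    ((numMessages R n - 1 : ℕ) : ℝ) ≤ (2 : ℝ) ^ ((n : ℝ) * R) := by
  have h := (Nat.ceil_lt_add_one (by positivity : (0 : ℝ) ≤ (2 : ℝ) ^ ((n : ℝ) * R))).le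
  rw [Nat.cast_sub (one_le_numMessages R n)]
  unfold numMessages
  push_cast
  linarith

theorem numMessages_zero (n : ℕ) : numMessages 0 n = 1 := by simp [numMessages]

theorem tendsto_two_rpow {x : ℝ} (hx : x < 0) :
    Tendsto (fun n : ℕ => (2 : ℝ) ^ ((n : ℝ) * x)) atTop (𝓝 0) := by
  have h : (fun n : ℕ => (2 : ℝ) ^ ((n : ℝ) * x)) = fun n : ℕ => ((2 : ℝ) ^ x) ^ n := by
    funext n
    rw [mul_comm, Real.rpow_mul (by norm_num), Real.rpow_natCast]
  rw [h]
  exact tendsto_pow_atTop_nhds_zero_of_lt_one (by positivity)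
    (Real.rpow_lt_one_of_one_lt_of_neg (by norm_num) hx)

theorem two_rpow_mul (n : ℕ) (x y : ℝ) :
    (2 : ℝ) ^ ((n : ℝ) * x) * (2 : ℝ) ^ ((n : ℝ) * y) = (2 : ℝ) ^ ((n : ℝ) * (x + y)) := by
  rw [mul_add, Real.rpow_add (by norm_num)]

theorem two_rpow_inv (n : ℕ) (x : ℝ) :
    ((2 : ℝ) ^ ((n : ℝ) * x))⁻¹ = (2 : ℝ) ^ ((n : ℝ) * (-x)) := by
  rw [mul_neg, Real.rpow_neg (by norm_num)]

/-- Number of wrong candidates times the probability of a false pass. At rate zero there is exactly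
one message, so the count of wrong ones is 0 and nothing is required of `γ`. -/
theorem tendsto_wrong_one {R r γ : ℝ} (hr : 0 ≤ r) (h : R = 0 ∨ R + r < γ) :
    Tendsto (fun n : ℕ => ((numMessages R n - 1 : ℕ) * numMessages r n : ℝ)
      * ((2 : ℝ) ^ ((n : ℝ) * γ))⁻¹) atTop (𝓝 0) := by
  rcases h with rfl | h
  · simp [numMessages_zero]
  have hlim := (tendsto_two_rpow (sub_neg.2 h)).const_mul 2
  rw [mul_zero] at hlim
  refine squeeze_zero (fun n => by positivity) (fun n => ?_) hlim
  calc _ ≤ (2 : ℝ) ^ ((n : ℝ) * R) * (2 * (2 : ℝ) ^ ((n : ℝ) * r))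
        * ((2 : ℝ) ^ ((n : ℝ) * γ))⁻¹ := by
        gcongr
        · exact numMessages_sub_one_le R n
        · exact numMessages_le hr n
    _ = 2 * (2 : ℝ) ^ ((n : ℝ) * (R + r - γ)) := by
        rw [two_rpow_inv, sub_eq_add_neg, ← two_rpow_mul, ← two_rpow_mul]; ring

theorem tendsto_wrong_two {R r R' r' γ : ℝ} (hr : 0 ≤ r) (hR' : 0 ≤ R') (hr' : 0 ≤ r')
    (h : R = 0 ∨ R + r + (R' + r') < γ) :
    Tendsto (fun n : ℕ => ((numMessages R n - 1 : ℕ) * numMessages r n : ℝ)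
      * (numMessages R' n * numMessages r' n : ℝ)
      * ((2 : ℝ) ^ ((n : ℝ) * γ))⁻¹) atTop (𝓝 0) := by
  rcases h with rfl | h
  · simp [numMessages_zero]
  -- The 8 collects a rounding factor 2 from each of `r`, `R'` and `r'`; the count of wrong messages
  -- at rate `R` needs none.
  have hlim := (tendsto_two_rpow (sub_neg.2 h)).const_mul 8
  rw [mul_zero] at hlim
  refine squeeze_zero (fun n => by positivity) (fun n => ?_) hlim
  calc _ ≤ (2 : ℝ) ^ ((n : ℝ) * R) * (2 * (2 : ℝ) ^ ((n : ℝ) * r))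
        * ((2 * (2 : ℝ) ^ ((n : ℝ) * R')) * (2 * (2 : ℝ) ^ ((n : ℝ) * r')))
        * ((2 : ℝ) ^ ((n : ℝ) * γ))⁻¹ := by
        gcongr
        · exact numMessages_sub_one_le R n
        · exact numMessages_le hr n
        · exact numMessages_le hR' n
        · exact numMessages_le hr' n
    _ = 8 * (2 : ℝ) ^ ((n : ℝ) * (R + r + (R' + r') - γ)) := by
        rw [two_rpow_inv, sub_eq_add_neg, ← two_rpow_mul, ← two_rpow_mul, ← two_rpow_mul,
          ← two_rpow_mul]
        ring

theorem tendsto_sqrt_cover {t r : ℝ} (h : t < r) :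
    Tendsto (fun n : ℕ => √((2 : ℝ) ^ ((n : ℝ) * t) / numMessages r n)) atTop (𝓝 0) := by
  have hlim := (Real.continuous_sqrt.tendsto 0).comp (tendsto_two_rpow (sub_neg.2 h))
  rw [Real.sqrt_zero] at hlim
  refine squeeze_zero (fun n => by positivity) (fun n => Real.sqrt_le_sqrt ?_) hlim
  calc _ ≤ (2 : ℝ) ^ ((n : ℝ) * t) / (2 : ℝ) ^ ((n : ℝ) * r) := by
        gcongr; exact le_numMessages r n
    _ = _ := by rw [div_eq_mul_inv, two_rpow_inv, two_rpow_mul, sub_eq_add_neg]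

end numMessages

/-! ### Vanishing of the one-shot bound -/

namespace CodingModel
open StateIC

variable {S U V X₁ X₂ Y₁ Y₂ : Type*} [Fintype S] [Fintype U] [Fintype V]
    [Fintype X₁] [Fintype X₂] [Fintype Y₁] [Fintype Y₂] (m : CodingModel S U V X₁ X₂ Y₁ Y₂)

theorem decodeBound_nonneg (A₁ : U → V → Y₁ → Prop) (A₂ : U → V → Y₂ → Prop)
    (M₁ L₁ M₂ L₂ : ℕ) : 0 ≤ m.decodeBound A₁ A₂ M₁ L₁ M₂ L₂ := by
  have nn : ∀ F : S → U → V → Y₁ × Y₂ → Prop, 0 ≤ m.joint (fun s u v y => ind (F s u v y)) :=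
    fun F => m.joint_nonneg fun _ _ _ _ => ind_nonneg _
  have mU := m.isMass_pU.1
  have mV := m.isMass_pV.1
  refine add_nonneg (add_nonneg (add_nonneg (add_nonneg (add_nonneg (nn _) (nn _)) ?_) ?_) ?_) ?_
  · exact mul_nonneg (by positivity) (wmean_nonneg mU fun u' => nn _)
  · exact mul_nonneg (by positivity) (wmean_nonneg mU fun u' => wmean_nonneg mV fun v' => nn _)
  · exact mul_nonneg (by positivity) (wmean_nonneg mV fun u' => nn _)
  · exact mul_nonneg (by positivity) (wmean_nonneg mU fun u' => wmean_nonneg mV fun v' => nn _)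

theorem block_density (n : ℕ) (s : Fin n → S) (u : Fin n → U) :
    (m.block n).a s u / (m.block n).pU u = ∏ i, m.a (s i) (u i) / m.pU (u i) := by
  rw [block_pU, Finset.prod_div_distrib]; rfl

theorem block_density' (n : ℕ) (s : Fin n → S) (v : Fin n → V) :
    (m.block n).b s v / (m.block n).pV v = ∏ i, m.b (s i) (v i) / m.pV (v i) := by
  rw [block_pV, Finset.prod_div_distrib]; rfl

theorem factors_pos {t : S × U × V × X₁ × X₂ × Y₁ × Y₂} (ht : m.law t ≠ 0) :
    0 < m.a t.1 t.2.1 ∧ 0 < m.b t.1 t.2.2.1 ∧ 0 < m.pU t.2.1 ∧ 0 < m.pV t.2.2.1 := by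
  refine ⟨lt_of_le_of_ne ((m.isMass_a _).1 _) fun h => ht ?_,
    lt_of_le_of_ne ((m.isMass_b _).1 _) fun h => ht ?_, ?_, ?_⟩
  · simp [law, ← h]
  · simp [law, ← h]
  · rw [pU_eq]; exact probEq_pos m.isMass_law.1 (fun t => t.2.1) ht
  · rw [pV_eq]; exact probEq_pos m.isMass_law.1 (fun t => t.2.2.1) ht

/-- A truncation exponent strictly between the mean information density and the codebook rate serves
both terms: the tail vanishes by the law of large numbers, and the square root decays exponentially.
-/
theorem tendsto_coverBound {r₁ r₂ : ℝ}
    (h₁ : wmean m.law (fun t => Real.logb 2 (m.a t.1 t.2.1 / m.pU t.2.1)) < r₁)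
    (h₂ : wmean m.law (fun t => Real.logb 2 (m.b t.1 t.2.2.1 / m.pV t.2.2.1)) < r₂) :
    ∃ t₁ t₂ : ℝ, Tendsto (fun n : ℕ => (m.block n).coverBound ((2 : ℝ) ^ ((n : ℝ) * t₁))
      ((2 : ℝ) ^ ((n : ℝ) * t₂)) (numMessages r₁ n) (numMessages r₂ n)) atTop (𝓝 0) := by
  obtain ⟨t₁, ht₁, ht₁'⟩ := exists_between h₁
  obtain ⟨t₂, ht₂, ht₂'⟩ := exists_between h₂
  refine ⟨t₁, t₂, ?_⟩
  unfold coverBound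
  simp only [block_density, block_density', block_joint]
  have l₁ := tendsto_lt_prod m.isMass_law (g := fun t => m.a t.1 t.2.1 / m.pU t.2.1)
    (fun t ht => div_pos (m.factors_pos ht).1 (m.factors_pos ht).2.2.1) rfl ht₁
  have l₂ := tendsto_lt_prod m.isMass_law (g := fun t => m.b t.1 t.2.2.1 / m.pV t.2.2.1)
    (fun t ht => div_pos (m.factors_pos ht).2.1 (m.factors_pos ht).2.2.2) rfl ht₂
  have := ((l₁.const_mul 2).add (tendsto_sqrt_cover ht₁')).add
    ((l₂.const_mul 2).add (tendsto_sqrt_cover ht₂'))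
  simpa only [mul_zero, add_zero] using this

theorem law_pos (t : S × U × V × X₁ × X₂ × Y₁ × Y₂) (ht : m.law t ≠ 0) {α : Type*}
    (X : S × U × V × X₁ × X₂ × Y₁ × Y₂ → α) : 0 < probEq m.law X (X t) :=
  probEq_pos m.isMass_law.1 X ht

/-- Threshold decoding succeeds at rates below the means of the information densities; a user with
zero rate needs no decoding. -/
theorem tendsto_decodeBound {R₁ R₂ r₁ r₂ c₁ e₁ c₂ e₂ : ℝ} (hR₁ : 0 ≤ R₁) (hR₂ : 0 ≤ R₂)
    (hr₁ : 0 ≤ r₁) (hr₂ : 0 ≤ r₂)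
    (hc₁ : wmean m.law (fun t => Real.logb 2
      (probEq m.law (fun t => (t.2.1, t.2.2.1, t.2.2.2.2.2.1)) (t.2.1, t.2.2.1, t.2.2.2.2.2.1) /
        (m.pU t.2.1 * probEq m.law (fun t => (t.2.2.1, t.2.2.2.2.2.1))
          (t.2.2.1, t.2.2.2.2.2.1)))) = c₁)
    (he₁ : wmean m.law (fun t => Real.logb 2
      (probEq m.law (fun t => (t.2.1, t.2.2.1, t.2.2.2.2.2.1)) (t.2.1, t.2.2.1, t.2.2.2.2.2.1) /
        (m.pU t.2.1 * (m.pV t.2.2.1 * probEq m.law (fun t => t.2.2.2.2.2.1)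
          t.2.2.2.2.2.1)))) = e₁)
    (hc₂ : wmean m.law (fun t => Real.logb 2
      (probEq m.law (fun t => (t.2.2.1, t.2.1, t.2.2.2.2.2.2)) (t.2.2.1, t.2.1, t.2.2.2.2.2.2) /
        (m.pV t.2.2.1 * probEq m.law (fun t => (t.2.1, t.2.2.2.2.2.2))
          (t.2.1, t.2.2.2.2.2.2)))) = c₂)
    (he₂ : wmean m.law (fun t => Real.logb 2
      (probEq m.law (fun t => (t.2.1, t.2.2.1, t.2.2.2.2.2.2)) (t.2.1, t.2.2.1, t.2.2.2.2.2.2) /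
        (m.pU t.2.1 * (m.pV t.2.2.1 * probEq m.law (fun t => t.2.2.2.2.2.2)
          t.2.2.2.2.2.2)))) = e₂)
    (k₁ : R₁ = 0 ∨ R₁ + r₁ < c₁) (l₁ : R₁ = 0 ∨ R₁ + r₁ + (R₂ + r₂) < e₁)
    (k₂ : R₂ = 0 ∨ R₂ + r₂ < c₂) (l₂ : R₂ = 0 ∨ R₂ + r₂ + (R₁ + r₁) < e₂) :
    ∃ (A₁ : ∀ n, (Fin n → U) → (Fin n → V) → (Fin n → Y₁) → Prop)
      (A₂ : ∀ n, (Fin n → U) → (Fin n → V) → (Fin n → Y₂) → Prop),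
      Tendsto (fun n : ℕ => (m.block n).decodeBound (A₁ n) (A₂ n) (numMessages R₁ n)
        (numMessages r₁ n) (numMessages R₂ n) (numMessages r₂ n)) atTop (𝓝 0) := by
  -- At rate zero any threshold below `c` will do, since only the true pair must pass; `c - 1` is
  -- arbitrary.
  have between : ∀ {R x c : ℝ}, (R = 0 ∨ x < c) → ∃ γ, γ < c ∧ (R = 0 ∨ x < γ) := by
    rintro R x c (h | h)
    · exact ⟨c - 1, by linarith, Or.inl h⟩
    · obtain ⟨γ, h₁, h₂⟩ := exists_between h
      exact ⟨γ, h₂, Or.inr h₁⟩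
  obtain ⟨γ₁, hγ₁, k₁⟩ := between k₁
  obtain ⟨η₁, hη₁, l₁⟩ := between l₁
  obtain ⟨γ₂, hγ₂, k₂⟩ := between k₂
  obtain ⟨η₂, hη₂, l₂⟩ := between l₂
  set P₁ := probEq m.law (fun t => (t.2.1, t.2.2.1, t.2.2.2.2.2.1)) with hP₁
  set P₂ := probEq m.law (fun t => (t.2.2.1, t.2.1, t.2.2.2.2.2.2)) with hP₂
  set P₃ := probEq m.law (fun t => (t.2.1, t.2.2.1, t.2.2.2.2.2.2)) with hP₃
  set Z₁ := probEq m.law (fun t => (t.2.2.1, t.2.2.2.2.2.1)) with hZ₁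
  set Z₂ := probEq m.law (fun t => (t.2.1, t.2.2.2.2.2.2)) with hZ₂
  set W₁ := probEq m.law (fun t => t.2.2.2.2.2.1) with hW₁
  set W₂ := probEq m.law (fun t => t.2.2.2.2.2.2) with hW₂
  have mP₁ : IsMass P₁ := isMass_probEq m.isMass_law _
  have mP₂ : IsMass P₂ := isMass_probEq m.isMass_law _
  have mP₃ : IsMass P₃ := isMass_probEq m.isMass_law _
  -- Each test is a conjunction. The first half excludes a wrong own codeword beside the true other
  -- one, the second half excludes two wrong codewords; each false-pass bound uses only its own
  -- half.
  let A₁ : ∀ n, (Fin n → U) → (Fin n → V) → (Fin n → Y₁) → Prop := fun n u v y =>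
    (2 : ℝ) ^ ((n : ℝ) * γ₁) * ∏ i, (m.pU (u i) * Z₁ (v i, y i)) < ∏ i, P₁ (u i, v i, y i) ∧
    (2 : ℝ) ^ ((n : ℝ) * η₁) * ∏ i, (m.pU (u i) * (m.pV (v i) * W₁ (y i)))
      < ∏ i, P₁ (u i, v i, y i)
  let A₂ : ∀ n, (Fin n → U) → (Fin n → V) → (Fin n → Y₂) → Prop := fun n u v y =>
    (2 : ℝ) ^ ((n : ℝ) * γ₂) * ∏ i, (m.pV (v i) * Z₂ (u i, y i)) < ∏ i, P₂ (v i, u i, y i) ∧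
    (2 : ℝ) ^ ((n : ℝ) * η₂) * ∏ i, (m.pU (u i) * (m.pV (v i) * W₂ (y i)))
      < ∏ i, P₃ (u i, v i, y i)
  refine ⟨A₁, A₂, ?_⟩
  have hL := m.isMass_law
  have posU := fun t ht => (m.factors_pos (t := t) ht).2.2.1
  have posV := fun t ht => (m.factors_pos (t := t) ht).2.2.2
  have b₁ := tendsto_not_test hL (P := fun t => P₁ (t.2.1, t.2.2.1, t.2.2.2.2.2.1))
    (Q := fun t => m.pU t.2.1 * Z₁ (t.2.2.1, t.2.2.2.2.2.1))
    (fun t ht => m.law_pos t ht (fun t => (t.2.1, t.2.2.1, t.2.2.2.2.2.1)))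
    (fun t ht => mul_pos (posU t ht) (m.law_pos t ht (fun t => (t.2.2.1, t.2.2.2.2.2.1)))) hc₁ hγ₁
  have b₂ := tendsto_not_test hL (P := fun t => P₁ (t.2.1, t.2.2.1, t.2.2.2.2.2.1))
    (Q := fun t => m.pU t.2.1 * (m.pV t.2.2.1 * W₁ t.2.2.2.2.2.1))
    (fun t ht => m.law_pos t ht (fun t => (t.2.1, t.2.2.1, t.2.2.2.2.2.1)))
    (fun t ht => mul_pos (posU t ht) (mul_pos (posV t ht) (m.law_pos t ht (fun t => t.2.2.2.2.2.1))))
    he₁ hη₁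
  have b₃ := tendsto_not_test hL (P := fun t => P₂ (t.2.2.1, t.2.1, t.2.2.2.2.2.2))
    (Q := fun t => m.pV t.2.2.1 * Z₂ (t.2.1, t.2.2.2.2.2.2))
    (fun t ht => m.law_pos t ht (fun t => (t.2.2.1, t.2.1, t.2.2.2.2.2.2)))
    (fun t ht => mul_pos (posV t ht) (m.law_pos t ht (fun t => (t.2.1, t.2.2.2.2.2.2)))) hc₂ hγ₂
  have b₄ := tendsto_not_test hL (P := fun t => P₃ (t.2.1, t.2.2.1, t.2.2.2.2.2.2))
    (Q := fun t => m.pU t.2.1 * (m.pV t.2.2.1 * W₂ t.2.2.2.2.2.2))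
    (fun t ht => m.law_pos t ht (fun t => (t.2.1, t.2.2.1, t.2.2.2.2.2.2)))
    (fun t ht => mul_pos (posU t ht) (mul_pos (posV t ht) (m.law_pos t ht (fun t => t.2.2.2.2.2.2))))
    he₂ hη₂
  have lim := ((((b₁.add b₂).add (b₃.add b₄)).add (tendsto_wrong_one hr₁ k₁)).add
    (tendsto_wrong_two hr₁ hR₂ hr₂ l₁)).add (tendsto_wrong_one hr₂ k₂) |>.add
    (tendsto_wrong_two hr₂ hR₁ hr₁ l₂)
  simp only [add_zero] at lim
  have ind_not_and : ∀ P Q : Prop, ind (¬ (P ∧ Q)) ≤ ind (¬ P) + ind (¬ Q) := fun P Q =>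
    (ind_mono (not_and_or.1)).trans (ind_or_le _ _)
  have hi := fun n => (isMass_iid (ι := Fin n) hL).1
  have hU := fun n => (isMass_iid (ι := Fin n) m.isMass_pU).1
  have hV := fun n => (isMass_iid (ι := Fin n) m.isMass_pV).1
  have two_pos : ∀ x : ℝ, 0 < (2 : ℝ) ^ x := fun x => by positivity
  refine squeeze_zero (fun n => ?_) (fun n => ?_) lim
  · exact (m.block n).decodeBound_nonneg _ _ _ _ _ _
  · unfold decodeBound
    simp only [block_joint, block_pU, block_pV]
    refine add_le_add (add_le_add (add_le_add (add_le_add (add_le_add ?_ ?_) ?_) ?_) ?_) ?_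
    · rw [← wmean_add]
      exact wmean_mono (hi n) fun t => ind_not_and _ _
    · rw [← wmean_add]
      exact wmean_mono (hi n) fun t => ind_not_and _ _
    · refine mul_le_mul_of_nonneg_left (le_trans ?_ (test_wrong_one (ι := Fin n) m.law
        (fun t => (t.2.2.1, t.2.2.2.2.2.1)) mP₁ (Q := m.pU) (two_pos _))) (by positivity)
      exact wmean_mono (hU n) fun u => wmean_mono (hi n) fun t => ind_mono And.left
    · refine mul_le_mul_of_nonneg_left (le_trans ?_ (test_wrong_two (ι := Fin n) m.law
        (fun t => t.2.2.2.2.2.1) mP₁ (Q := m.pU) (Q' := m.pV) (two_pos _))) (by positivity)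
      exact wmean_mono (hU n) fun u => wmean_mono (hV n) fun v => wmean_mono (hi n) fun t =>
        ind_mono And.right
    · refine mul_le_mul_of_nonneg_left (le_trans ?_ (test_wrong_one (ι := Fin n) m.law
        (fun t => (t.2.1, t.2.2.2.2.2.2)) mP₂ (Q := m.pV) (two_pos _))) (by positivity)
      exact wmean_mono (hV n) fun v => wmean_mono (hi n) fun t => ind_mono And.left
    · refine mul_le_mul_of_nonneg_left (le_trans ?_ (test_wrong_two (ι := Fin n) m.law
        (fun t => t.2.2.2.2.2.2) mP₃ (Q := m.pU) (Q' := m.pV) (two_pos _))) (by positivity)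
      exact wmean_mono (hU n) fun u => wmean_mono (hV n) fun v => wmean_mono (hi n) fun t =>
        ind_mono And.right

end CodingModel

/-! ### Information inequalities and chain rules -/

section information
variable {Ω : Type*} [Fintype Ω] {p : Ω → ℝ}

/-- Used to identify joint laws of the same variables listed or bracketed differently. -/
theorem probEq_injective_comp {Ω α β : Type*} [Fintype Ω] (p : Ω → ℝ) (X : Ω → α) {φ : α → β}
    (hφ : Function.Injective φ) (x : α) :
    probEq p (fun ω => φ (X ω)) (φ x) = probEq p X x := by
  simp only [probEq_eq_wmean, hφ.eq_iff]

open Classical in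
theorem sum_probEq_fst {Ω α γ : Type*} [Fintype Ω] [Fintype α] (p : Ω → ℝ) (X : Ω → α)
    (Z : Ω → γ) (z : γ) : ∑ x, probEq p (fun ω => (X ω, Z ω)) (x, z) = probEq p Z z := by
  unfold probEq
  rw [Finset.sum_comm]
  refine Finset.sum_congr rfl fun ω _ => ?_
  by_cases h : Z ω = z <;> simp [h]

/-- From log x ≥ 1 - 1/x, the claim reduces to the mean of P(x,z) P(y,z) / (P(x,y,z) P(z)) being at
most 1. Enlarging the sum to all triples and summing out x and y leaves the total mass of the law of
`Z`. -/
theorem condMutualInfo_nonneg {α β γ : Type*} [Fintype α] [Fintype β] [Fintype γ]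
    (hp : IsMass p) (X : Ω → α) (Y : Ω → β) (Z : Ω → γ) : 0 ≤ condMutualInfo p X Y Z := by
  set P := probEq p (fun ω => (X ω, Y ω, Z ω)) with hP
  set A := probEq p (fun ω => (X ω, Z ω)) with hA
  set B := probEq p (fun ω => (Y ω, Z ω)) with hB
  set C := probEq p Z with hC
  have nP : ∀ x, 0 ≤ P x := probEq_nonneg hp.1 _
  have nA : ∀ x, 0 ≤ A x := probEq_nonneg hp.1 _
  have nB : ∀ x, 0 ≤ B x := probEq_nonneg hp.1 _
  have nC : ∀ x, 0 ≤ C x := probEq_nonneg hp.1 _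
  have hlog : 0 < Real.log 2 := Real.log_pos (by norm_num)
  have step : wmean p (fun ω => (1 - A (X ω, Z ω) * B (Y ω, Z ω) /
      (P (X ω, Y ω, Z ω) * C (Z ω))) / Real.log 2) ≤ condMutualInfo p X Y Z := by
    refine wmean_le_of_ne_zero hp.1 fun ω hω => ?_
    have p₁ : 0 < P (X ω, Y ω, Z ω) := probEq_pos hp.1 (fun ω => (X ω, Y ω, Z ω)) hω
    have p₂ : 0 < A (X ω, Z ω) := probEq_pos hp.1 (fun ω => (X ω, Z ω)) hω
    have p₃ : 0 < B (Y ω, Z ω) := probEq_pos hp.1 (fun ω => (Y ω, Z ω)) hω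
    have p₄ : 0 < C (Z ω) := probEq_pos hp.1 Z hω
    have h := Real.one_sub_inv_le_log_of_pos
      (show 0 < P (X ω, Y ω, Z ω) * C (Z ω) / (A (X ω, Z ω) * B (Y ω, Z ω)) by positivity)
    rw [inv_div] at h
    exact div_le_div_of_nonneg_right h hlog.le
  refine le_trans ?_ step
  simp only [div_eq_mul_inv _ (Real.log 2)]
  rw [wmean_mul_const, wmean_sub, wmean_const hp]
  refine mul_nonneg (sub_nonneg.2 ?_) (inv_nonneg.2 hlog.le)
  refine (wmean_probEq p (fun ω => (X ω, Y ω, Z ω))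
    (fun t => A (t.1, t.2.2) * B (t.2.1, t.2.2) *
      (P (t.1, t.2.1, t.2.2) * C t.2.2)⁻¹)).symm.trans_le ?_
  have h₁ : wmean P (fun t => A (t.1, t.2.2) * B (t.2.1, t.2.2) *
      (P (t.1, t.2.1, t.2.2) * C t.2.2)⁻¹)
      ≤ ∑ t : α × β × γ, A (t.1, t.2.2) * B (t.2.1, t.2.2) * (C t.2.2)⁻¹ := by
    refine Finset.sum_le_sum fun t _ => ?_
    by_cases hz : P t = 0
    · rw [hz, zero_mul]
      exact mul_nonneg (mul_nonneg (nA _) (nB _)) (inv_nonneg.2 (nC _))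
    · refine le_of_eq ?_
      change P t * (A (t.1, t.2.2) * B (t.2.1, t.2.2) * (P t * C t.2.2)⁻¹) = _
      rw [mul_inv]
      field_simp
  refine h₁.trans ?_
  have h₂ : ∑ t : α × β × γ, A (t.1, t.2.2) * B (t.2.1, t.2.2) * (C t.2.2)⁻¹
      = ∑ z, C z * C z * (C z)⁻¹ := by
    rw [Fintype.sum_prod_type]
    simp only [Fintype.sum_prod_type]
    calc _ = ∑ z, (∑ x, A (x, z)) * (∑ y, B (y, z)) * (C z)⁻¹ := by
          simp only [Finset.sum_mul_sum]; simp only [Finset.sum_mul]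
          exact (Finset.sum_congr rfl fun x _ => Finset.sum_comm).trans Finset.sum_comm
      _ = _ := by
          refine Finset.sum_congr rfl fun z _ => ?_
          rw [sum_probEq_fst p X Z z, sum_probEq_fst p Y Z z]
  rw [h₂, ← (isMass_probEq hp Z).2]
  refine Finset.sum_le_sum fun z _ => ?_
  by_cases hz : C z = 0
  · simp [hz, ← hC]
  · rw [mul_assoc, mul_inv_cancel₀ hz, mul_one]

theorem mutualInfo_nonneg {α β : Type*} [Fintype α] [Fintype β] (hp : IsMass p) (X : Ω → α)
    (Y : Ω → β) : 0 ≤ mutualInfo p X Y := by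
  have h : mutualInfo p X Y = condMutualInfo p X Y (fun _ => ()) := by
    have h₁ : probEq p (fun _ => ()) () = 1 := by simp [probEq, hp.2]
    unfold mutualInfo condMutualInfo
    refine Finset.sum_congr rfl fun ω _ => ?_
    rw [h₁, mul_one,
      probEq_injective_comp p X (φ := fun x => (x, ())) (fun _ _ h => (Prod.ext_iff.1 h).1),
      probEq_injective_comp p Y (φ := fun x => (x, ())) (fun _ _ h => (Prod.ext_iff.1 h).1),
      probEq_injective_comp p (fun ω => (X ω, Y ω)) (φ := fun x => (x.1, x.2, ()))
        (fun a b h => Prod.ext (Prod.ext_iff.1 h).1 (Prod.ext_iff.1 (Prod.ext_iff.1 h).2).1)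
        (X ω, Y ω)]
  rw [h]
  exact condMutualInfo_nonneg hp X Y _

/-- Four-variable version of `I(AB;CD) = I(A;D) + I(A;C|D) + I(B;CD|A)`. -/
theorem mutualInfo_pair_pair {α β γ δ : Type*} (hp : IsMass p) (A : Ω → α) (B : Ω → β)
    (C : Ω → γ) (D : Ω → δ) :
    mutualInfo p (fun ω => (A ω, B ω)) (fun ω => (C ω, D ω))
      = mutualInfo p A D + condMutualInfo p A C D
        + condMutualInfo p B (fun ω => (C ω, D ω)) A := by
  change wmean p _ = wmean p _ + wmean p _ + wmean p _
  rw [← wmean_add, ← wmean_add]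
  refine wmean_congr_of_ne_zero fun ω hω => ?_
  have e₁ := probEq_injective_comp p (fun ω => (A ω, C ω, D ω))
    (φ := fun t => ((t.2.1, t.2.2), t.1)) (by rintro ⟨_, _, _⟩ ⟨_, _, _⟩ h; simp_all)
    (A ω, C ω, D ω)
  have e₂ := probEq_injective_comp p (fun ω => ((A ω, B ω), (C ω, D ω)))
    (φ := fun t => (t.1.2, t.2, t.1.1)) (by rintro ⟨⟨_, _⟩, _⟩ ⟨⟨_, _⟩, _⟩ h; simp_all)
    ((A ω, B ω), (C ω, D ω))
  have e₃ := probEq_injective_comp p (fun ω => (A ω, B ω)) (φ := Prod.swap)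
    Prod.swap_injective (A ω, B ω)
  simp only [Prod.swap] at e₁ e₂ e₃
  -- Once the joint laws are matched, the chain rule is an identity between products of densities,
  -- valid at every point of positive mass. The two chain rules that follow use the same argument.
  rw [e₁, e₂, e₃]
  have p₁ := probEq_pos hp.1 (fun ω => (A ω, C ω, D ω)) hω
  have p₂ := probEq_pos hp.1 (fun ω => ((A ω, B ω), (C ω, D ω))) hω
  have p₃ := probEq_pos hp.1 (fun ω => (A ω, B ω)) hω
  have p₄ := probEq_pos hp.1 (fun ω => (C ω, D ω)) hω
  have p₅ := probEq_pos hp.1 (fun ω => (A ω, D ω)) hω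
  have p₆ := probEq_pos hp.1 A hω
  have p₇ := probEq_pos hp.1 D hω
  rw [← Real.logb_mul (by positivity) (by positivity), ← Real.logb_mul (by positivity)
    (by positivity)]
  congr 1
  field_simp

/-- `I(C;(A,B),D) = I(C;A) + I(C;D|A) + I(C;B|A,D)`. -/
theorem mutualInfo_triple {α β γ δ : Type*} (hp : IsMass p) (A : Ω → α) (B : Ω → β)
    (C : Ω → γ) (D : Ω → δ) :
    mutualInfo p C (fun ω => ((A ω, B ω), D ω))
      = mutualInfo p C A + condMutualInfo p C D A
        + condMutualInfo p C B (fun ω => (A ω, D ω)) := by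
  change wmean p _ = wmean p _ + wmean p _ + wmean p _
  rw [← wmean_add, ← wmean_add]
  refine wmean_congr_of_ne_zero fun ω hω => ?_
  have e₁ := probEq_injective_comp p (fun ω => (C ω, D ω, A ω))
    (φ := fun t => (t.1, t.2.2, t.2.1)) (by rintro ⟨_, _, _⟩ ⟨_, _, _⟩ h; simp_all)
    (C ω, D ω, A ω)
  have e₂ := probEq_injective_comp p (fun ω => (C ω, ((A ω, B ω), D ω)))
    (φ := fun t => (t.1, t.2.1.2, t.2.1.1, t.2.2))
    (by rintro ⟨_, ⟨_, _⟩, _⟩ ⟨_, ⟨_, _⟩, _⟩ h; simp_all) (C ω, ((A ω, B ω), D ω))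
  have e₃ := probEq_injective_comp p (fun ω => (A ω, D ω)) (φ := Prod.swap)
    Prod.swap_injective (A ω, D ω)
  have e₄ := probEq_injective_comp p (fun ω => ((A ω, B ω), D ω))
    (φ := fun t => (t.1.2, t.1.1, t.2)) (by rintro ⟨⟨_, _⟩, _⟩ ⟨⟨_, _⟩, _⟩ h; simp_all)
    ((A ω, B ω), D ω)
  simp only [Prod.swap] at e₁ e₂ e₃ e₄
  rw [e₁, e₂, e₃, e₄]
  have p₁ := probEq_pos hp.1 (fun ω => (C ω, D ω, A ω)) hω
  have p₂ := probEq_pos hp.1 (fun ω => (C ω, ((A ω, B ω), D ω))) hω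
  have p₃ := probEq_pos hp.1 (fun ω => (A ω, D ω)) hω
  have p₄ := probEq_pos hp.1 (fun ω => ((A ω, B ω), D ω)) hω
  have p₅ := probEq_pos hp.1 (fun ω => (C ω, A ω)) hω
  have p₆ := probEq_pos hp.1 A hω
  have p₇ := probEq_pos hp.1 C hω
  rw [← Real.logb_mul (by positivity) (by positivity), ← Real.logb_mul (by positivity)
    (by positivity)]
  congr 1
  field_simp

/-- The total correlation of `(A,B)`, `C` and `D`, as
`I(A;D) + I(B;CD|A) + I(C;A) + I(C;D|A)`. -/
theorem totalCorrelation_eq {α β γ δ : Type*} (hp : IsMass p) (A : Ω → α) (B : Ω → β)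
    (C : Ω → γ) (D : Ω → δ) :
    wmean p (fun ω => Real.logb 2 (probEq p (fun ω => ((A ω, B ω), C ω, D ω))
        ((A ω, B ω), C ω, D ω) /
      (probEq p (fun ω => (A ω, B ω)) (A ω, B ω) * (probEq p C (C ω) * probEq p D (D ω)))))
      = mutualInfo p A D + condMutualInfo p B (fun ω => (C ω, D ω)) A
        + (mutualInfo p C A + condMutualInfo p C D A) := by
  change wmean p _ = wmean p _ + wmean p _ + (wmean p _ + wmean p _)
  rw [← wmean_add, ← wmean_add, ← wmean_add]
  refine wmean_congr_of_ne_zero fun ω hω => ?_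
  have e₁ := probEq_injective_comp p (fun ω => (C ω, D ω, A ω))
    (φ := fun t => ((t.1, t.2.1), t.2.2)) (by rintro ⟨_, _, _⟩ ⟨_, _, _⟩ h; simp_all)
    (C ω, D ω, A ω)
  have e₂ := probEq_injective_comp p (fun ω => ((A ω, B ω), (C ω, D ω)))
    (φ := fun t => (t.1.2, t.2, t.1.1)) (by rintro ⟨⟨_, _⟩, _⟩ ⟨⟨_, _⟩, _⟩ h; simp_all)
    ((A ω, B ω), (C ω, D ω))
  have e₃ := probEq_injective_comp p (fun ω => (A ω, B ω)) (φ := Prod.swap)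
    Prod.swap_injective (A ω, B ω)
  have e₄ := probEq_injective_comp p (fun ω => (A ω, D ω)) (φ := Prod.swap)
    Prod.swap_injective (A ω, D ω)
  simp only [Prod.swap] at e₁ e₂ e₃ e₄
  rw [e₁, e₂, e₃, e₄]
  have p₁ := probEq_pos hp.1 (fun ω => (C ω, D ω, A ω)) hω
  have p₂ := probEq_pos hp.1 (fun ω => ((A ω, B ω), (C ω, D ω))) hω
  have p₃ := probEq_pos hp.1 (fun ω => (A ω, B ω)) hω
  have p₄ := probEq_pos hp.1 (fun ω => (A ω, D ω)) hω
  have p₅ := probEq_pos hp.1 (fun ω => (C ω, A ω)) hω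
  have p₆ := probEq_pos hp.1 A hω
  have p₇ := probEq_pos hp.1 C hω
  have p₈ := probEq_pos hp.1 D hω
  rw [← Real.logb_mul (by positivity) (by positivity), ← Real.logb_mul (by positivity)
    (by positivity), ← Real.logb_mul (by positivity) (by positivity)]
  congr 1
  field_simp

/-! ### Invariance of information under relabelling of the sample space -/

variable {Ω' : Type*} [Fintype Ω'] {p' : Ω' → ℝ}

theorem probEq_equiv {α : Type*} (e : Ω ≃ Ω') (h : ∀ ω, p ω = p' (e ω))
    (X : Ω' → α) (x : α) :
    probEq p (fun ω => X (e ω)) x = probEq p' X x := by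
  classical
  unfold probEq
  exact Fintype.sum_equiv e _ _ fun ω => by rw [h]

theorem mutualInfo_equiv {α β : Type*} (e : Ω ≃ Ω') (h : ∀ ω, p ω = p' (e ω))
    (X : Ω' → α) (Y : Ω' → β) :
    mutualInfo p (fun ω => X (e ω)) (fun ω => Y (e ω)) = mutualInfo p' X Y := by
  unfold mutualInfo
  refine Fintype.sum_equiv e _ _ fun ω => ?_
  rw [probEq_equiv e h (fun t => (X t, Y t)), probEq_equiv e h X, probEq_equiv e h Y, h]

theorem condMutualInfo_equiv {α β γ : Type*} (e : Ω ≃ Ω') (h : ∀ ω, p ω = p' (e ω))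
    (X : Ω' → α) (Y : Ω' → β) (Z : Ω' → γ) :
    condMutualInfo p (fun ω => X (e ω)) (fun ω => Y (e ω)) (fun ω => Z (e ω))
      = condMutualInfo p' X Y Z := by
  unfold condMutualInfo
  refine Fintype.sum_equiv e _ _ fun ω => ?_
  rw [probEq_equiv e h (fun t => (X t, Y t, Z t)), probEq_equiv e h (fun t => (X t, Z t)),
    probEq_equiv e h (fun t => (Y t, Z t)), probEq_equiv e h Z, h]

end information

/-! ### The interference channel with auxiliary variables -/

theorem isMass_pmf {α : Type*} [Fintype α] (P : PMF α) : IsMass (fun a => (P a).toReal) := by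
  refine ⟨fun a => ENNReal.toReal_nonneg, ?_⟩
  rw [← ENNReal.toReal_sum fun a _ => P.apply_ne_top a, ← tsum_fintype (L := .unconditional _),
    P.tsum_coe, ENNReal.toReal_one]

/-- As `m.a s` depends on `s` only through `σ s`, it is also the conditional law of u given `σ s`.
With `σ` the projection to S₁, this makes the covering cost I(U;S₁), although the encoders see both
states. -/
theorem CodingModel.probEq_law_pair {S U V X₁ X₂ Y₁ Y₂ Γ : Type*} [Fintype S] [Fintype U]
    [Fintype V] [Fintype X₁] [Fintype X₂] [Fintype Y₁] [Fintype Y₂]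
    (m : CodingModel S U V X₁ X₂ Y₁ Y₂) (σ : S → Γ) (hσ : ∀ s s', σ s = σ s' → m.a s = m.a s')
    (s : S) (u : U) :
    probEq m.law (fun t => (t.2.1, σ t.1)) (u, σ s)
      = m.a s u * probEq m.law (fun t => σ t.1) (σ s) := by
  have h₁ := m.joint_eq_wmean_law (fun s' u' _ _ => ind ((u', σ s') = (u, σ s)))
  have h₂ := m.joint_eq_wmean_law (fun s' _ _ _ => ind (σ s' = σ s))
  rw [m.joint_fst (fun s' u' => ind ((u', σ s') = (u, σ s)))] at h₁
  rw [m.joint_fst (fun s' _ => ind (σ s' = σ s))] at h₂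
  rw [probEq_eq_wmean, probEq_eq_wmean, ← h₁, ← h₂, ← wmean_const_mul]
  refine congrArg _ (funext fun s' => ?_)
  rw [wmean_const (m.isMass_a s')]
  by_cases h : σ s' = σ s
  · rw [← hσ _ _ h, h, ind_of_true rfl, mul_one]
    classical
    simp [wmean, ind]
  · simp [wmean, ind, h]

theorem CodingModel.probEq_law_pair' {S U V X₁ X₂ Y₁ Y₂ Γ : Type*} [Fintype S] [Fintype U]
    [Fintype V] [Fintype X₁] [Fintype X₂] [Fintype Y₁] [Fintype Y₂]
    (m : CodingModel S U V X₁ X₂ Y₁ Y₂) (σ : S → Γ) (hσ : ∀ s s', σ s = σ s' → m.b s = m.b s')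
    (s : S) (v : V) :
    probEq m.law (fun t => (t.2.2.1, σ t.1)) (v, σ s)
      = m.b s v * probEq m.law (fun t => σ t.1) (σ s) := by
  have h₁ := m.joint_eq_wmean_law (fun s' _ v' _ => ind ((v', σ s') = (v, σ s)))
  have h₂ := m.joint_eq_wmean_law (fun s' _ _ _ => ind (σ s' = σ s))
  rw [m.joint_snd (fun s' v' => ind ((v', σ s') = (v, σ s)))] at h₁
  rw [m.joint_snd (fun s' _ => ind (σ s' = σ s))] at h₂
  rw [probEq_eq_wmean, probEq_eq_wmean, ← h₁, ← h₂, ← wmean_const_mul]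
  refine congrArg _ (funext fun s' => ?_)
  rw [wmean_const (m.isMass_b s')]
  by_cases h : σ s' = σ s
  · rw [← hσ _ _ h, h, ind_of_true rfl, mul_one]
    classical
    simp [wmean, ind]
  · simp [wmean, ind, h]

namespace StateIC

theorem avgError_nonneg {S₁ S₂ X₁ X₂ Y₁ Y₂ : Type*} [Fintype S₁] [Fintype S₂] [Fintype Y₁]
    [Fintype Y₂] (ch : StateIC S₁ S₂ X₁ X₂ Y₁ Y₂) {n M₁ M₂ : ℕ}
    (c : ICCode S₁ S₂ X₁ X₂ Y₁ Y₂ n M₁ M₂) :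
    0 ≤ ch.avgError c := by
  refine mul_nonneg (by positivity) (Finset.sum_nonneg fun w₁ _ => Finset.sum_nonneg fun w₂ _ => ?_)
  unfold errorProb
  refine Finset.sum_nonneg fun _ _ => Finset.sum_nonneg fun _ _ => Finset.sum_nonneg fun _ _ =>
    Finset.sum_nonneg fun _ _ => ?_
  split_ifs
  · exact mul_nonneg (Finset.prod_nonneg fun _ _ => ENNReal.toReal_nonneg)
      (Finset.prod_nonneg fun _ _ => ENNReal.toReal_nonneg)
  · exact le_rfl

variable {S₁ S₂ X₁ X₂ Y₁ Y₂ U₁ U₂ V : Type*}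
    [Fintype S₁] [Fintype S₂] [Fintype X₁] [Fintype X₂] [Fintype Y₁] [Fintype Y₂]
    [Fintype U₁] [Fintype U₂] [Fintype V]
    (ch : StateIC S₁ S₂ X₁ X₂ Y₁ Y₂) (q : AuxLaw S₁ X₁ X₂ U₁ U₂ V)

/-- The coding model with state `(S₁, S₂)` and auxiliary variables `(U₁, U₂)` and `V`. -/
noncomputable def codingModel : CodingModel (S₁ × S₂) (U₁ × U₂) V X₁ X₂ Y₁ Y₂ where
  pS s := (ch.stateLaw s).toReal
  a s u := (q.lawU₁ s.1 u.1).toReal * (q.lawU₂ s.1 u.1 u.2).toReal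
  b s v := (q.lawV s.1 v).toReal
  q₁ s u x := (q.lawX₁ s.1 u.1 u.2 x).toReal
  q₂ s v x := (q.lawX₂ v s.1 x).toReal
  W s x₁ x₂ y := (ch.trans s.1 s.2 x₁ x₂ y).toReal
  isMass_pS := isMass_pmf _
  isMass_a s := (isMass_pmf (q.lawU₁ s.1)).mul fun u₁ => isMass_pmf (q.lawU₂ s.1 u₁)
  isMass_b _ := isMass_pmf _
  isMass_q₁ _ _ := isMass_pmf _
  isMass_q₂ _ _ := isMass_pmf _
  isMass_W _ _ _ := isMass_pmf _

/-- Regrouping of the coordinates of the joint space. -/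
def jointEquiv (S₁ S₂ X₁ X₂ Y₁ Y₂ U₁ U₂ V : Type*) : JointSpace S₁ S₂ X₁ X₂ Y₁ Y₂ U₁ U₂ V ≃
    (S₁ × S₂) × (U₁ × U₂) × V × X₁ × X₂ × Y₁ × Y₂ where
  toFun ω := ((ω.1, ω.2.1), (ω.2.2.2.2.1, ω.2.2.2.2.2.1), ω.2.2.1, ω.2.2.2.2.2.2.1, ω.2.2.2.1,
    ω.2.2.2.2.2.2.2.1, ω.2.2.2.2.2.2.2.2)
  invFun t := (t.1.1, t.1.2, t.2.2.1, t.2.2.2.2.1, t.2.1.1, t.2.1.2, t.2.2.2.1, t.2.2.2.2.2.1,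
    t.2.2.2.2.2.2)
  left_inv _ := rfl
  right_inv _ := rfl

theorem jointLaw_eq (ω : JointSpace S₁ S₂ X₁ X₂ Y₁ Y₂ U₁ U₂ V) :
    ch.jointLaw q ω = (ch.codingModel q).law (jointEquiv S₁ S₂ X₁ X₂ Y₁ Y₂ U₁ U₂ V ω) := by
  obtain ⟨s₁, s₂, v, x₂, u₁, u₂, x₁, y₁, y₂⟩ := ω
  simp only [jointLaw, codingModel, CodingModel.law, jointEquiv, Equiv.coe_fn_mk]
  ring

/-- A deterministic code for the block model as a code for the channel. -/
def blockCode {n M₁ M₂ : ℕ} (f₁ : Fin M₁ → (Fin n → S₁ × S₂) → Fin n → X₁)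
    (f₂ : Fin M₂ → (Fin n → S₁ × S₂) → Fin n → X₂) (g₁ : (Fin n → Y₁) → Fin M₁)
    (g₂ : (Fin n → Y₂) → Fin M₂) : ICCode S₁ S₂ X₁ X₂ Y₁ Y₂ n M₁ M₂ where
  enc₁ w s₁ s₂ := f₁ w fun i => (s₁ i, s₂ i)
  enc₂ w s₁ s₂ := f₂ w fun i => (s₁ i, s₂ i)
  dec₁ := g₁
  dec₂ := g₂

theorem errorProb_blockCode {n M₁ M₂ : ℕ} (f₁ : Fin M₁ → (Fin n → S₁ × S₂) → Fin n → X₁)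
    (f₂ : Fin M₂ → (Fin n → S₁ × S₂) → Fin n → X₂) (g₁ : (Fin n → Y₁) → Fin M₁)
    (g₂ : (Fin n → Y₂) → Fin M₂) (w₁ : Fin M₁) (w₂ : Fin M₂) :
    ch.errorProb (blockCode f₁ f₂ g₁ g₂) w₁ w₂
      = wmean ((ch.codingModel q).block n).pS fun s =>
          wmean (((ch.codingModel q).block n).W s (f₁ w₁ s) (f₂ w₂ s)) fun y =>
            ind ((g₁ y.1, g₂ y.2) ≠ (w₁, w₂)) := by
  classical
  simp only [errorProb, wmean]
  rw [← Fintype.sum_prod_type' (f := fun (s₁ : Fin n → S₁) (s₂ : Fin n → S₂) =>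
    ∑ y₁ : Fin n → Y₁, ∑ y₂ : Fin n → Y₂, _)]
  refine Fintype.sum_equiv
    (Equiv.arrowProdEquivProdArrow (Fin n) (fun _ => S₁) (fun _ => S₂)).symm _ _ fun s => ?_
  rw [Finset.mul_sum, Fintype.sum_prod_type]
  refine Finset.sum_congr rfl fun y₁ _ => Finset.sum_congr rfl fun y₂ _ => ?_
  by_cases h : (g₁ y₁, g₂ y₂) ≠ (w₁, w₂)
  · rw [ind_of_true h, mul_one]; exact if_pos h
  · rw [ind_of_false h, mul_zero, mul_zero]; exact if_neg h

/-- The one-shot theorem is applied to the block model at each length, with `numMessages r₁ n` and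
`numMessages r₂ n` codewords per message; the sum over message pairs is then normalized. -/
theorem achievable_of_tendsto {R₁ R₂ r₁ r₂ : ℝ} (hR₁ : 0 ≤ R₁) (hR₂ : 0 ≤ R₂)
    {A₁ : ∀ n, (Fin n → U₁ × U₂) → (Fin n → V) → (Fin n → Y₁) → Prop}
    {A₂ : ∀ n, (Fin n → U₁ × U₂) → (Fin n → V) → (Fin n → Y₂) → Prop} {t₁ t₂ : ℝ}
    (hd : Tendsto (fun n : ℕ => ((ch.codingModel q).block n).decodeBound (A₁ n) (A₂ n)
      (numMessages R₁ n) (numMessages r₁ n) (numMessages R₂ n) (numMessages r₂ n)) atTop (𝓝 0))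
    (hc : Tendsto (fun n : ℕ => ((ch.codingModel q).block n).coverBound
      ((2 : ℝ) ^ ((n : ℝ) * t₁)) ((2 : ℝ) ^ ((n : ℝ) * t₂)) (numMessages r₁ n)
      (numMessages r₂ n)) atTop (𝓝 0)) :
    ch.Achievable R₁ R₂ := by
  have nz : ∀ R n, NeZero (numMessages R n) := fun R n =>
    ⟨(Nat.one_le_iff_ne_zero.1 (one_le_numMessages R n))⟩
  have hcode : ∀ n, ∃ c : ICCode S₁ S₂ X₁ X₂ Y₁ Y₂ n (numMessages R₁ n) (numMessages R₂ n),
      ch.avgError c ≤ ((ch.codingModel q).block n).decodeBound (A₁ n) (A₂ n)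
        (numMessages R₁ n) (numMessages r₁ n) (numMessages R₂ n) (numMessages r₂ n)
        + ((ch.codingModel q).block n).coverBound
          ((2 : ℝ) ^ ((n : ℝ) * t₁)) ((2 : ℝ) ^ ((n : ℝ) * t₂)) (numMessages r₁ n)
          (numMessages r₂ n) := by
    intro n
    have := nz R₁ n
    have := nz R₂ n
    have := nz r₁ n
    have := nz r₂ n
    obtain ⟨f₁, f₂, g₁, g₂, h⟩ := ((ch.codingModel q).block n).exists_code
      (M₁ := numMessages R₁ n) (M₂ := numMessages R₂ n) (L₁ := numMessages r₁ n)
      (L₂ := numMessages r₂ n) (A₁ n) (A₂ n)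
      (by positivity : (0 : ℝ) ≤ (2 : ℝ) ^ ((n : ℝ) * t₁))
      (by positivity : (0 : ℝ) ≤ (2 : ℝ) ^ ((n : ℝ) * t₂))
    refine ⟨blockCode f₁ f₂ g₁ g₂, ?_⟩
    unfold avgError
    simp only [ch.errorProb_blockCode q]
    have hM : (0 : ℝ) < (numMessages R₁ n : ℝ) * (numMessages R₂ n : ℝ) := by
      have h₁ : (1 : ℝ) ≤ numMessages R₁ n := by exact_mod_cast one_le_numMessages R₁ n
      have h₂ : (1 : ℝ) ≤ numMessages R₂ n := by exact_mod_cast one_le_numMessages R₂ n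
      positivity
    rw [one_div_mul_eq_div, div_le_iff₀ hM, mul_comm]
    exact h
  choose c hcode using hcode
  refine ⟨hR₁, hR₂, c, ?_⟩
  have lim := hd.add hc
  rw [add_zero] at lim
  exact squeeze_zero (fun n => ch.avgError_nonneg (c n)) hcode lim

/-- Achievability, where a rate may equal its bound if it is zero. -/
theorem achievable_of_le {p : JointSpace S₁ S₂ X₁ X₂ Y₁ Y₂ U₁ U₂ V → ℝ} (hp : p = ch.jointLaw q)
    {B₁ B₂ : ℝ}
    (hB₁ : B₁ =
      min (mutualInfo p JointSpace.rvU₁ JointSpace.rvY₁)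
          (mutualInfo p JointSpace.rvU₁ JointSpace.rvY₂)
      + min (condMutualInfo p JointSpace.rvU₂
              (fun ω => (JointSpace.rvV ω, JointSpace.rvY₁ ω)) JointSpace.rvU₁)
            (condMutualInfo p JointSpace.rvU₂
              (fun ω => (JointSpace.rvV ω, JointSpace.rvY₂ ω)) JointSpace.rvU₁)
      - mutualInfo p (fun ω => (JointSpace.rvU₁ ω, JointSpace.rvU₂ ω)) JointSpace.rvS₁)
    (hB₂ : B₂ =
      min (condMutualInfo p JointSpace.rvV JointSpace.rvY₁ JointSpace.rvU₁)
          (condMutualInfo p JointSpace.rvV JointSpace.rvY₂ JointSpace.rvU₁)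
      - mutualInfo p JointSpace.rvV JointSpace.rvS₁)
    {R₁ R₂ : ℝ} (hR₁ : 0 ≤ R₁) (hR₂ : 0 ≤ R₂) (h₁ : R₁ ≤ B₁) (h₂ : R₂ ≤ B₂)
    (h₁' : R₁ = 0 ∨ R₁ < B₁) (h₂' : R₂ = 0 ∨ R₂ < B₂) : ch.Achievable R₁ R₂ := by
  set m := ch.codingModel q with hm
  set e := jointEquiv S₁ S₂ X₁ X₂ Y₁ Y₂ U₁ U₂ V with he
  have hL := m.isMass_law
  have hpe : ∀ ω, p ω = m.law (e ω) := fun ω => by rw [hp]; exact ch.jointLaw_eq q ω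
  let T := (S₁ × S₂) × (U₁ × U₂) × V × X₁ × X₂ × Y₁ × Y₂
  let A : T → U₁ := fun t => t.2.1.1
  let B : T → U₂ := fun t => t.2.1.2
  let C : T → V := fun t => t.2.2.1
  let D₁ : T → Y₁ := fun t => t.2.2.2.2.2.1
  let D₂ : T → Y₂ := fun t => t.2.2.2.2.2.2
  let St : T → S₁ := fun t => t.1.1
  have hB₁' : B₁ = min (mutualInfo m.law A D₁) (mutualInfo m.law A D₂)
      + min (condMutualInfo m.law B (fun t => (C t, D₁ t)) A)
          (condMutualInfo m.law B (fun t => (C t, D₂ t)) A)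
      - mutualInfo m.law (fun t => (A t, B t)) St := by
    rw [hB₁, ← mutualInfo_equiv e hpe A D₁, ← mutualInfo_equiv e hpe A D₂,
      ← condMutualInfo_equiv e hpe B (fun t => (C t, D₁ t)) A,
      ← condMutualInfo_equiv e hpe B (fun t => (C t, D₂ t)) A,
      ← mutualInfo_equiv e hpe (fun t => (A t, B t)) St]
    rfl
  have hB₂' : B₂ = min (condMutualInfo m.law C D₁ A) (condMutualInfo m.law C D₂ A)
      - mutualInfo m.law C St := by
    rw [hB₂, ← condMutualInfo_equiv e hpe C D₁ A, ← condMutualInfo_equiv e hpe C D₂ A,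
      ← mutualInfo_equiv e hpe C St]
    rfl
  -- The factor P(S₁) cancels in P(U,S₁) / (P(U) P(S₁)), leaving the ratio of kernel to marginal.
  have iU : wmean m.law (fun t => Real.logb 2 (m.a t.1 t.2.1 / m.pU t.2.1))
      = mutualInfo m.law (fun t => (A t, B t)) St := by
    refine wmean_congr_of_ne_zero fun t ht => ?_
    have h := m.probEq_law_pair Prod.fst (fun s s' h => by
      simp only [hm, codingModel, h]) t.1 t.2.1
    have hpos : 0 < probEq m.law St (St t) := probEq_pos hL.1 St ht
    rw [m.pU_eq]
    change _ = Real.logb 2 (probEq m.law (fun t => (t.2.1, t.1.1)) (t.2.1, t.1.1) /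
      (probEq m.law (fun t => t.2.1) t.2.1 * probEq m.law St (St t)))
    rw [h, mul_div_mul_right _ _ hpos.ne']
  have iV : wmean m.law (fun t => Real.logb 2 (m.b t.1 t.2.2.1 / m.pV t.2.2.1))
      = mutualInfo m.law C St := by
    refine wmean_congr_of_ne_zero fun t ht => ?_
    have h := m.probEq_law_pair' Prod.fst (fun s s' h => by
      simp only [hm, codingModel, h]) t.1 t.2.2.1
    have hpos : 0 < probEq m.law St (St t) := probEq_pos hL.1 St ht
    rw [m.pV_eq]
    change _ = Real.logb 2 (probEq m.law (fun t => (t.2.2.1, t.1.1)) (t.2.2.1, t.1.1) /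
      (probEq m.law (fun t => t.2.2.1) t.2.2.1 * probEq m.law St (St t)))
    rw [h, mul_div_mul_right _ _ hpos.ne']
  set IU := mutualInfo m.law (fun t => (A t, B t)) St with hIU
  set IV := mutualInfo m.law C St with hIV
  have nIU : 0 ≤ IU := mutualInfo_nonneg hL _ _
  have nIV : 0 ≤ IV := mutualInfo_nonneg hL _ _
  have nCA := mutualInfo_nonneg hL C A
  have n₁ := condMutualInfo_nonneg hL A C D₁
  have n₂ := condMutualInfo_nonneg hL C B (fun t => (A t, D₂ t))
  have c₁ := mutualInfo_pair_pair hL A B C D₁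
  have c₂ := mutualInfo_triple hL A B C D₂
  have e₁ := totalCorrelation_eq hL A B C D₁
  have e₂ := totalCorrelation_eq hL A B C D₂
  have a₁ := min_le_left (mutualInfo m.law A D₁) (mutualInfo m.law A D₂)
  have a₂ := min_le_right (mutualInfo m.law A D₁) (mutualInfo m.law A D₂)
  have a₃ := min_le_left (condMutualInfo m.law B (fun t => (C t, D₁ t)) A)
          (condMutualInfo m.law B (fun t => (C t, D₂ t)) A)
  have a₄ := min_le_right (condMutualInfo m.law B (fun t => (C t, D₁ t)) A)
          (condMutualInfo m.law B (fun t => (C t, D₂ t)) A)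
  have a₅ := min_le_left (condMutualInfo m.law C D₁ A) (condMutualInfo m.law C D₂ A)
  have a₆ := min_le_right (condMutualInfo m.law C D₁ A) (condMutualInfo m.law C D₂ A)
  -- Both covering rates exceed their information by δ, and both enter the sum-rate conditions. The
  -- room 2δ comes from one user alone, since the other may meet its bound with equality.
  have slack : ∀ {R B : ℝ}, (R = 0 ∨ R < B) → ∃ δ > 0, R = 0 ∨ R + 2 * δ < B := by
    rintro R B (h | h)
    · exact ⟨1, one_pos, Or.inl h⟩
    · exact ⟨(B - R) / 4, by linarith, Or.inr (by linarith)⟩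
  obtain ⟨δ₁, hδ₁, s₁⟩ := slack h₁'
  obtain ⟨δ₂, hδ₂, s₂⟩ := slack h₂'
  set δ := min δ₁ δ₂ with hδ
  have hδ0 : 0 < δ := lt_min hδ₁ hδ₂
  have d₁ : δ ≤ δ₁ := min_le_left _ _
  have d₂ : δ ≤ δ₂ := min_le_right _ _
  obtain ⟨t₁, t₂, hc⟩ := m.tendsto_coverBound (r₁ := IU + δ) (r₂ := IV + δ)
    (by rw [iU]; linarith) (by rw [iV]; linarith)
  obtain ⟨A₁, A₂, hd⟩ := m.tendsto_decodeBound (R₁ := R₁) (R₂ := R₂) (r₁ := IU + δ)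
    (r₂ := IV + δ)
    (c₁ := mutualInfo m.law A D₁ + condMutualInfo m.law A C D₁
      + condMutualInfo m.law B (fun t => (C t, D₁ t)) A)
    (e₁ := mutualInfo m.law A D₁ + condMutualInfo m.law B (fun t => (C t, D₁ t)) A
      + (mutualInfo m.law C A + condMutualInfo m.law C D₁ A))
    (c₂ := mutualInfo m.law C A + condMutualInfo m.law C D₂ A
      + condMutualInfo m.law C B (fun t => (A t, D₂ t)))
    (e₂ := mutualInfo m.law A D₂ + condMutualInfo m.law B (fun t => (C t, D₂ t)) A
      + (mutualInfo m.law C A + condMutualInfo m.law C D₂ A))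
    hR₁ hR₂ (by linarith) (by linarith)
    (by rw [m.pU_eq]; exact c₁) (by rw [m.pU_eq, m.pV_eq]; exact e₁)
    (by rw [m.pV_eq]; exact c₂) (by rw [m.pU_eq, m.pV_eq]; exact e₂)
    -- The individual conditions drop I(U₁;V|Y₁) at receiver 1, and I(V;U₁) and I(V;U₂|U₁Y₂) at
    -- receiver 2. The sum conditions add the two rate bounds and drop I(V;U₁); they are where each
    -- receiver's share of both minima is used.
    (s₁.imp_right fun h => by linarith) (s₁.imp_right fun h => by linarith)
    (s₂.imp_right fun h => by linarith) (s₂.imp_right fun h => by linarith)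
  exact ch.achievable_of_tendsto q hR₁ hR₂ hd hc

end StateIC

/-! ### The theorem: strict rates and passage to the closure -/

theorem proposition3
    {S₁ S₂ X₁ X₂ Y₁ Y₂ U₁ U₂ V : Type*}
    [Fintype S₁] [Fintype S₂] [Fintype X₁] [Fintype X₂] [Fintype Y₁] [Fintype Y₂]
    [Fintype U₁] [Fintype U₂] [Fintype V]
    (ch : StateIC S₁ S₂ X₁ X₂ Y₁ Y₂) (q : AuxLaw S₁ X₁ X₂ U₁ U₂ V)
    (p : JointSpace S₁ S₂ X₁ X₂ Y₁ Y₂ U₁ U₂ V → ℝ) (hp : p = ch.jointLaw q)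
    (B₁ B₂ : ℝ)
    (hB₁ : B₁ =
      min (mutualInfo p JointSpace.rvU₁ JointSpace.rvY₁)
          (mutualInfo p JointSpace.rvU₁ JointSpace.rvY₂)
      + min (condMutualInfo p JointSpace.rvU₂
              (fun ω => (JointSpace.rvV ω, JointSpace.rvY₁ ω)) JointSpace.rvU₁)
            (condMutualInfo p JointSpace.rvU₂
              (fun ω => (JointSpace.rvV ω, JointSpace.rvY₂ ω)) JointSpace.rvU₁)
      - mutualInfo p (fun ω => (JointSpace.rvU₁ ω, JointSpace.rvU₂ ω)) JointSpace.rvS₁)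
    (hB₂ : B₂ =
      min (condMutualInfo p JointSpace.rvV JointSpace.rvY₁ JointSpace.rvU₁)
          (condMutualInfo p JointSpace.rvV JointSpace.rvY₂ JointSpace.rvU₁)
      - mutualInfo p JointSpace.rvV JointSpace.rvS₁)
    (R₁ R₂ : ℝ) (hR₁ : 0 ≤ R₁) (hR₂ : 0 ≤ R₂) :
    (R₁ < B₁ → R₂ < B₂ → ch.Achievable R₁ R₂) ∧
      (R₁ ≤ B₁ → R₂ ≤ B₂ → (R₁, R₂) ∈ ch.capacityRegion) := by
  refine ⟨fun h₁ h₂ => ch.achievable_of_le q hp hB₁ hB₂ hR₁ hR₂ h₁.le h₂.le (Or.inr h₁)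
    (Or.inr h₂), fun h₁ h₂ => ?_⟩
  have hε : Tendsto (fun n : ℕ => 1 / ((n : ℝ) + 1)) atTop (𝓝 0) :=
    tendsto_one_div_add_atTop_nhds_zero_nat
  have hlim : ∀ {R : ℝ}, 0 ≤ R →
      Tendsto (fun n : ℕ => max (R - 1 / ((n : ℝ) + 1)) 0) atTop (𝓝 R) := by
    intro R hR
    have := (hε.const_sub R).max (tendsto_const_nhds (x := (0 : ℝ)))
    rwa [sub_zero, max_eq_left hR] at this
  -- Lowering a rate and clipping at zero gives zero or a value strictly below the bound. Clipping
  -- matters when the bound itself is 0, where no nonnegative rate is strictly smaller.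
  have below : ∀ {R B : ℝ} (n : ℕ), 0 ≤ R → R ≤ B → max (R - 1 / ((n : ℝ) + 1)) 0 ≤ B ∧
      (max (R - 1 / ((n : ℝ) + 1)) 0 = 0 ∨ max (R - 1 / ((n : ℝ) + 1)) 0 < B) := by
    intro R B n hR hRB
    have hpos : (0 : ℝ) < 1 / ((n : ℝ) + 1) := by positivity
    refine ⟨max_le (by linarith) (hR.trans hRB), ?_⟩
    rcases le_total (R - 1 / ((n : ℝ) + 1)) 0 with h | h
    · exact Or.inl (max_eq_right h)
    · exact Or.inr (by rw [max_eq_left h]; linarith)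
  refine mem_closure_of_tendsto ((hlim hR₁).prodMk_nhds (hlim hR₂))
    (Eventually.of_forall fun n => ?_)
  exact ch.achievable_of_le q hp hB₁ hB₂ (le_max_right _ _) (le_max_right _ _)
    (below n hR₁ h₁).1 (below n hR₂ h₂).1 (below n hR₁ h₁).2 (below n hR₂ h₂).2
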